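/- An acyclic edge coloring of a finite simple graph $G$ is an assignment of colors to the edges of $G$ such that distinct edges with a common endpoint receive different colors and every cycle of $G$ receives more than two colors. A randomized algorithm is a program for a random access machine that operates on natural numbers with unit-cost instructions (constants, copying, addition, truncated subtraction, indirect reading and writing of memory cells, zero tests for branches and loops) and that can flip independent fair coins; its running time is the number of steps that it makes. Theorem 6.1. There are a randomized algorithm and a polynomial $p$ with the following property. Let $G$ be a finite simple graph with $n$ edges and maximum degree $\Delta$, with vertices $0,\dots,v-1$, given to the algorithm by $v$, $n$ and a list of its edges (in any order, each edge as a pair of endpoints in any order). Then the expected running time of the algorithm on $G$ is at most $p(n)$ (in particular it halts with probability $1$), and whenever it halts, its output is an acyclic edge coloring of $G$ with colors from a set of $16\Delta$ colors. -/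

import Mathlib

open scoped ENNReal

/-! ## Acyclic edge colorings -/

namespace SimpleGraph

/-- An edge coloring `c` of `G` with colors in `K` is acyclic if it is proper (distinct edges with
a common endpoint receive distinct colors) and every cycle of `G` receives more than two colors. -/
structure IsAcyclicEdgeColoring {V K : Type*} (G : SimpleGraph V) (c : G.EdgeLabeling K) :
    Prop where
  proper : ∀ e f : G.edgeSet, e ≠ f → (∃ v, v ∈ (e : Sym2 V) ∧ v ∈ (f : Sym2 V)) → c e ≠ c f
  acyclic : ∀ (u : V) (w : G.Walk u u), w.IsCycle →
    2 < (c '' {e : G.edgeSet | (e : Sym2 V) ∈ w.edges}).encard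

/-- The list `es` of ordered pairs of vertices lists every edge of `G` exactly once, in an
arbitrary order and with an arbitrary choice of which endpoint comes first. -/
structure IsEdgeListing {V : Type*} (G : SimpleGraph V) (es : List (V × V)) : Prop where
  nodup : (es.map fun p => s(p.1, p.2)).Nodup
  mem_iff : ∀ e : Sym2 V, e ∈ es.map (fun p => s(p.1, p.2)) ↔ e ∈ G.edgeSet

end SimpleGraph

/-! ## A randomized random access machine

The machine has registers `0, 1, 2, …` and arrays `0, 1, 2, …` (each with cells `0, 1, 2, …`), all
holding natural numbers; a program mentions only finitely many registers and arrays. The arithmetic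
instructions are addition and truncated subtraction (no multiplication, no shifts), so that the
length of the binary expansion of the largest number in the machine grows by at most one per step,
and unit-cost time is polynomially related to time on a Turing machine. The only source of
randomness is an instruction that flips a fair coin. -/

namespace RandRAM

/-- Programs of the machine. -/
inductive Cmd : Type
  /-- do nothing -/
  | skip : Cmd
  /-- `const r k`: put the constant `k` into register `r` -/
  | const (r k : ℕ) : Cmd
  /-- `copy r a`: `r := a` -/
  | copy (r a : ℕ) : Cmd
  /-- `add r a b`: `r := a + b` -/
  | add (r a b : ℕ) : Cmd
  /-- `sub r a b`: `r := max (a - b) 0` -/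
  | sub (r a b : ℕ) : Cmd
  /-- `load r A i`: `r := A[i]`, where `i` is a register and `A` is an array -/
  | load (r A i : ℕ) : Cmd
  /-- `store A i r`: `A[i] := r`, where `i` is a register and `A` is an array -/
  | store (A i r : ℕ) : Cmd
  /-- `flip r`: put the outcome, `0` or `1`, of a new coin flip into register `r` -/
  | flip (r : ℕ) : Cmd
  /-- run the first program, then the second one -/
  | seq (p q : Cmd) : Cmd
  /-- `ite r p q`: if register `r` is not `0` then run `p`, else run `q` -/
  | ite (r : ℕ) (p q : Cmd) : Cmd
  /-- `loop r p`: while register `r` is not `0`, run `p` -/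
  | loop (r : ℕ) (p : Cmd) : Cmd

/-- The memory of the machine, with the number of coins that have been used so far. -/
structure State : Type where
  /-- contents of the registers -/
  reg : ℕ → ℕ
  /-- `arr A i` is the content of cell `i` of array `A` -/
  arr : ℕ → ℕ → ℕ
  /-- number of coin flips made so far -/
  used : ℕ

/-- Put `x` into register `r`. -/
def State.setReg (s : State) (r x : ℕ) : State :=
  { s with reg := Function.update s.reg r x }

/-- Put `x` into cell `i` of array `A`. -/
def State.setArr (s : State) (A i x : ℕ) : State :=
  { s with arr := Function.update s.arr A (Function.update (s.arr A) i x) }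

/-- A configuration: the commands that remain to be executed (the first one comes next) and the
current memory. -/
structure Config : Type where
  todo : List Cmd
  state : State

/-- One step of the machine, where `ω j` is the outcome of the `j`-th coin flip. Every elementary
instruction, every evaluation of the test of a conditional or of a loop, and every unfolding of a
sequence takes one step. A configuration in which nothing remains to be executed is final. -/
def step (ω : ℕ → Bool) : Config → Config
  | ⟨[], s⟩ => ⟨[], s⟩
  | ⟨.skip :: K, s⟩ => ⟨K, s⟩
  | ⟨.const r k :: K, s⟩ => ⟨K, s.setReg r k⟩
  | ⟨.copy r a :: K, s⟩ => ⟨K, s.setReg r (s.reg a)⟩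
  | ⟨.add r a b :: K, s⟩ => ⟨K, s.setReg r (s.reg a + s.reg b)⟩
  | ⟨.sub r a b :: K, s⟩ => ⟨K, s.setReg r (s.reg a - s.reg b)⟩
  | ⟨.load r A i :: K, s⟩ => ⟨K, s.setReg r (s.arr A (s.reg i))⟩
  | ⟨.store A i r :: K, s⟩ => ⟨K, s.setArr A (s.reg i) (s.reg r)⟩
  | ⟨.flip r :: K, s⟩ => ⟨K, { s.setReg r (ω s.used).toNat with used := s.used + 1 }⟩
  | ⟨.seq p q :: K, s⟩ => ⟨p :: q :: K, s⟩
  | ⟨.ite r p q :: K, s⟩ => if s.reg r ≠ 0 then ⟨p :: K, s⟩ else ⟨q :: K, s⟩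
  | ⟨.loop r p :: K, s⟩ => if s.reg r ≠ 0 then ⟨p :: .loop r p :: K, s⟩ else ⟨K, s⟩

/-- The configuration that the program `P`, started in memory `s`, has reached after `t` steps
when the coin flips are `ω`. -/
def run (P : Cmd) (s : State) (ω : ℕ → Bool) (t : ℕ) : Config :=
  (step ω)^[t] ⟨[P], s⟩

/-- The program has halted after at most `t` steps. -/
def HaltedBy (P : Cmd) (s : State) (ω : ℕ → Bool) (t : ℕ) : Prop :=
  (run P s ω t).todo = []

/-- The number of steps that the program makes, which is `∞` if it does not halt. -/
noncomputable def runningTime (P : Cmd) (s : State) (ω : ℕ → Bool) : ℝ≥0∞ :=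
  ⨅ (t : ℕ) (_ : HaltedBy P s ω t), (t : ℝ≥0∞)

/-- The law of an infinite sequence of independent fair coin flips. -/
noncomputable def coinMeasure : MeasureTheory.Measure (ℕ → Bool) :=
  MeasureTheory.Measure.infinitePi fun _ : ℕ => (PMF.uniformOfFintype Bool).toMeasure

/-- The expected number of steps of the program `P` started in memory `s`. -/
noncomputable def expectedTime (P : Cmd) (s : State) : ℝ≥0∞ :=
  ∫⁻ ω, runningTime P s ω ∂coinMeasure

/-- The initial memory for a graph with vertices `0, …, v - 1` that is given by the list `es` of
its edges: register `0` holds the number of vertices, register `1` holds the number of edges, cell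
`i` of array `0` and cell `i` of array `1` hold the endpoints of the `i`-th edge, and everything
else is `0`. -/
def graphInput {v : ℕ} (es : List (Fin v × Fin v)) : State where
  reg r := if r = 0 then v else if r = 1 then es.length else 0
  arr A i :=
    if A = 0 then (es.map fun p => (p.1 : ℕ)).getD i 0
    else if A = 1 then (es.map fun p => (p.2 : ℕ)).getD i 0
    else 0
  used := 0

/-- The memory `s` contains the edge coloring `c` of `G`: for every `i`, cell `i` of array `2` holds
the color of the `i`-th edge in the list `es`. -/
def HoldsColoring {v k : ℕ} {G : SimpleGraph (Fin v)} (es : List (Fin v × Fin v))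
    (c : G.EdgeLabeling (Fin k)) (s : State) : Prop :=
  ∀ (i : ℕ) (hi : i < es.length) (h : s(es[i].1, es[i].2) ∈ G.edgeSet),
    s.arr 2 i = (c ⟨s(es[i].1, es[i].2), h⟩ : ℕ)

end RandRAM

/-!
Colors are drawn one at a time: as long as some edge is uncolored, color one such edge uniformly at
random; on a conflict at a vertex uncolor it again, and on a closed two-colored walk uncolor all
but two edges of the walk. The uncolored edges are recovered from a record of the step, because the
colors along the walk have period two. So the history of the process is determined by the records
and the current partial coloring, and a potential that charges each record its weight shows that
the expected number of drawings is linear in the number of edges. Each drawing is a program of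
polynomial cost, and programs over named variables compile to the random access machine.
-/

open scoped NNReal

noncomputable section

/-! ### Two-colored walks -/

/-- The least `j < n` with `P j`, or `n` if there is no such `j`. -/
def firstBelow (n : ℕ) (P : ℕ → Prop) : ℕ := sInf {j | j < n → P j}

section FirstBelow

variable {n j : ℕ} {P Q : ℕ → Prop}

theorem firstBelow_le : firstBelow n P ≤ n := Nat.sInf_le fun h => absurd h (lt_irrefl n)

theorem firstBelow_spec (h : firstBelow n P < n) : P (firstBelow n P) :=
  Nat.sInf_mem (s := {j | j < n → P j}) ⟨n, fun h => absurd h (lt_irrefl n)⟩ h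

theorem not_of_lt_firstBelow (h : j < firstBelow n P) : ¬ P j :=
  fun hP => Nat.notMem_of_lt_sInf h fun _ => hP

theorem firstBelow_lt_iff : firstBelow n P < n ↔ ∃ j < n, P j :=
  ⟨fun h => ⟨_, h, firstBelow_spec h⟩,
    fun ⟨_, hj, hP⟩ => lt_of_le_of_lt (Nat.sInf_le fun _ => hP) hj⟩

theorem firstBelow_eq (hj : j < n) (hP : P j) (hmin : ∀ i < j, ¬ P i) : firstBelow n P = j :=
  le_antisymm (Nat.sInf_le fun _ => hP) <| not_lt.1 fun h =>
    hmin _ h (firstBelow_spec (h.trans hj))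

theorem firstBelow_congr (h : ∀ j < n, (P j ↔ Q j)) : firstBelow n P = firstBelow n Q := by
  unfold firstBelow
  congr 1
  ext j
  exact forall_congr' (h j)

end FirstBelow

/-- A list of the edges `0, …, size - 1` of a graph on the natural numbers, the `i`-th of which
joins `src i` and `dst i`. -/
structure EdgeArray : Type where
  size : ℕ
  src : ℕ → ℕ
  dst : ℕ → ℕ

/-- A position of a two-colored walk: it has just traversed `edge`, has arrived at `vertex`, and
will continue with an edge of color `next`. -/
structure WalkPos : Type where
  edge : ℕ
  vertex : ℕ
  next : ℕ

namespace EdgeArray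

/-- The vertex `w` is an endpoint of the edge `j`. -/
def Inc (E : EdgeArray) (j w : ℕ) : Prop := E.src j = w ∨ E.dst j = w

/-- The endpoint of the edge `j` other than `w`. -/
def other (E : EdgeArray) (j w : ℕ) : ℕ := E.src j + E.dst j - w

/-- The graph has no loops and no multiple edges. -/
structure Simple (E : EdgeArray) : Prop where
  loopless : ∀ i < E.size, E.src i ≠ E.dst i
  inj : ∀ i < E.size, ∀ j < E.size, ∀ w w', w ≠ w' →
    E.Inc i w → E.Inc i w' → E.Inc j w → E.Inc j w' → i = j

/-- Distinct edges with a common endpoint do not have the same color. Here and below a coloring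
is partial, and the color `0` means that an edge is uncolored. -/
def Proper (E : EdgeArray) (c : ℕ → ℕ) : Prop :=
  ∀ i < E.size, ∀ j < E.size, ∀ w, c i ≠ 0 → c i = c j → E.Inc i w → E.Inc j w → i = j

open Classical in
/-- The set of edges at the vertex `w`. -/
def star (E : EdgeArray) (w : ℕ) : Finset ℕ := {j ∈ Finset.range E.size | E.Inc j w}

open Classical in
/-- One step of a two-colored walk, which stops when it has traversed `e` and when it cannot be
continued. -/
def advance (E : EdgeArray) (c : ℕ → ℕ) (e : ℕ) (s : WalkPos) : WalkPos :=
  let q := firstBelow E.size fun j => c j = s.next ∧ E.Inc j s.vertex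
  if s.edge ≠ e ∧ q < E.size then ⟨q, E.other q s.vertex, c s.edge⟩ else s

/-- The position after `i` steps of the two-colored walk that starts with the edge `j` at the
vertex `dst e`, so that it continues a walk that has arrived there over `e`. -/
def trace (E : EdgeArray) (c : ℕ → ℕ) (e j i : ℕ) : WalkPos :=
  (E.advance c e)^[i] ⟨j, E.other j (E.dst e), c e⟩

/-- The two-colored walk from `e` over `dst e` to `j` returns to `e`. -/
def Closes (E : EdgeArray) (c : ℕ → ℕ) (e j : ℕ) : Prop :=
  c j ≠ 0 ∧ j ≠ e ∧ E.Inc j (E.dst e) ∧ (E.trace c e j E.size).edge = e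

open Classical in
/-- Uncolor all but the first two edges of the two-colored walk from `e` over `dst e` to `j`. -/
def uncolor (E : EdgeArray) (c : ℕ → ℕ) (e j : ℕ) : ℕ → ℕ :=
  fun q => if ∃ i, 2 ≤ i ∧ i ≤ E.size ∧ (E.trace c e j i).edge = q then 0 else c q

/-- The edge `j` has the color `a` and an endpoint in common with `e`. -/
def Conflict (E : EdgeArray) (c : ℕ → ℕ) (e a j : ℕ) : Prop :=
  c j = a ∧ (E.Inc j (E.src e) ∨ E.Inc j (E.dst e))

open Classical in
/-- One round of the algorithm, which tries to give the edge `e` the color `a`. -/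
def round (E : EdgeArray) (c : ℕ → ℕ) (e a : ℕ) : ℕ → ℕ :=
  let c' := Function.update c e a
  if ∃ j < E.size, E.Conflict c e a j then c
  else if ∃ j < E.size, E.Closes c' e j then E.uncolor c' e (firstBelow E.size (E.Closes c' e))
  else c'

variable {E : EdgeArray} {c : ℕ → ℕ} {e i j k w x : ℕ}

theorem mem_star : j ∈ E.star w ↔ j < E.size ∧ E.Inc j w := by simp [star]

theorem inc_other (h : E.Inc j w) : E.Inc j (E.other j w) := by
  unfold Inc other at *
  omega

theorem eq_or_eq_other (h : E.Inc j w) (hx : E.Inc j x) : x = w ∨ x = E.other j w := by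
  unfold Inc other at *
  omega

theorem Simple.other_ne (hE : E.Simple) (hj : j < E.size) (h : E.Inc j w) : E.other j w ≠ w := by
  have := hE.loopless j hj
  unfold Inc other at *
  omega

/-- The position `s'` is reached from the position `s` by one step of a two-colored walk. -/
structure Follows (E : EdgeArray) (c : ℕ → ℕ) (s s' : WalkPos) : Prop where
  edge_lt : s'.edge < E.size
  color_edge : c s'.edge = s.next
  inc : E.Inc s'.edge s.vertex
  vertex_eq : s'.vertex = E.other s'.edge s.vertex
  next_eq : s'.next = c s.edge

theorem advance_of_edge_eq {s : WalkPos} (h : s.edge = e) : E.advance c e s = s := by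
  simp [advance, h]

theorem advance_eq_self_or_follows (s : WalkPos) :
    E.advance c e s = s ∨ E.Follows c s (E.advance c e s) := by
  unfold advance
  dsimp only
  split_ifs with h
  · have hq := firstBelow_spec h.2
    exact .inr ⟨h.2, hq.1, hq.2, rfl, rfl⟩
  · exact .inl rfl

theorem trace_succ : E.trace c e j (i + 1) = E.advance c e (E.trace c e j i) :=
  Function.iterate_succ_apply' _ _ _

theorem trace_eq_of_advance_eq (h : E.advance c e (E.trace c e j i) = E.trace c e j i)
    (hk : i ≤ k) : E.trace c e j k = E.trace c e j i := by
  induction k, hk using Nat.le_induction with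
  | base => rfl
  | succ k _ ih => rw [trace_succ, ih, h]

theorem trace_eq_of_edge_eq (h : (E.trace c e j i).edge = e) (hk : i ≤ k) :
    E.trace c e j k = E.trace c e j i :=
  trace_eq_of_advance_eq (advance_of_edge_eq h) hk

theorem follows_trace (hk : (E.trace c e j k).edge = e) (hik : i ≤ k)
    (hi : (E.trace c e j i).edge ≠ e) :
    E.Follows c (E.trace c e j i) (E.trace c e j (i + 1)) := by
  rw [trace_succ]
  refine (advance_eq_self_or_follows _).resolve_left fun h => hi ?_
  rw [← trace_eq_of_advance_eq h hik, hk]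

/-- The vertices of `trace`, beginning with the common vertex of `e` and `j`. -/
def traceVertex (E : EdgeArray) (c : ℕ → ℕ) (e j : ℕ) : ℕ → ℕ
  | 0 => E.dst e
  | i + 1 => (E.trace c e j i).vertex

theorem trace_edge_lt_and_colors (hj : j < E.size) (m : ℕ)
    (h : ∀ i < m, E.Follows c (E.trace c e j i) (E.trace c e j (i + 1))) :
    ∀ i ≤ m, (E.trace c e j i).edge < E.size ∧
      c (E.trace c e j i).edge = (if i % 2 = 0 then c j else c e) ∧
      (E.trace c e j i).next = if i % 2 = 0 then c e else c j := by
  intro i hi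
  induction i with
  | zero => exact ⟨hj, rfl, rfl⟩
  | succ i ih =>
    obtain ⟨-, hcolor, hnext⟩ := ih (by omega)
    have hstep := h i hi
    have hpar : (i + 1) % 2 = 0 ↔ ¬ i % 2 = 0 := by omega
    simp only [hpar, ite_not, ← hcolor, ← hnext]
    exact ⟨hstep.edge_lt, hstep.color_edge, hstep.next_eq⟩

/-- A closed walk with edges `e, p 0, …, p m = e` and vertices `dst e = w 0, …, w (m + 1)`, whose
edges have the color of `e` and that of `p 0` alternately. -/
structure IsAltWalk (E : EdgeArray) (c : ℕ → ℕ) (e m : ℕ) (p w : ℕ → ℕ) : Prop where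
  vertex_zero : w 0 = E.dst e
  edge_last : p m = e
  edge_ne : ∀ i < m, p i ≠ e
  edge_lt : ∀ i ≤ m, p i < E.size
  inc : ∀ i ≤ m, E.Inc (p i) (w i)
  vertex_succ : ∀ i ≤ m, w (i + 1) = E.other (p i) (w i)
  color : ∀ i ≤ m, c (p i) = if i % 2 = 0 then c (p 0) else c e
  color_zero_ne : c (p 0) ≠ c e
  color_zero_ne_zero : c (p 0) ≠ 0
  color_last_ne_zero : c e ≠ 0

theorem Closes.exists_isAltWalk (hc : E.Proper c) (he : e < E.size) (hce : c e ≠ 0)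
    (hj : j < E.size) (h : E.Closes c e j) :
    ∃ m ≤ E.size, E.IsAltWalk c e m (fun i => (E.trace c e j i).edge) (E.traceVertex c e j) := by
  classical
  obtain ⟨hcj, hje, hinc, hn⟩ := h
  have hex : ∃ i, (E.trace c e j i).edge = e := ⟨_, hn⟩
  obtain ⟨m, ⟨hm, hlt⟩, hmn⟩ : ∃ m, ((E.trace c e j m).edge = e ∧
      ∀ i < m, (E.trace c e j i).edge ≠ e) ∧ m ≤ E.size :=
    ⟨Nat.find hex, (Nat.find_eq_iff hex).1 rfl, Nat.find_min' hex hn⟩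
  have hstep : ∀ i < m, E.Follows c (E.trace c e j i) (E.trace c e j (i + 1)) :=
    fun i hi => follows_trace hm hi.le (hlt i hi)
  have hcol := trace_edge_lt_and_colors hj m hstep
  exact ⟨m, hmn,
    { vertex_zero := rfl
      edge_last := hm
      edge_ne := hlt
      edge_lt := fun i hi => (hcol i hi).1
      inc := by
        rintro (_ | i) hi
        · exact hinc
        · exact (hstep i hi).inc
      vertex_succ := by
        rintro (_ | i) hi
        · rfl
        · exact (hstep i hi).vertex_eq
      color := fun i hi => (hcol i hi).2.1
      color_zero_ne := fun h => hje (hc j hj e he _ hcj h hinc (.inr rfl))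
      color_zero_ne_zero := hcj
      color_last_ne_zero := hce }⟩

namespace IsAltWalk

variable {m : ℕ} {p w : ℕ → ℕ}

theorem last_lt (h : E.IsAltWalk c e m p w) : e < E.size := h.edge_last ▸ h.edge_lt m le_rfl

theorem color_eq_iff (h : E.IsAltWalk c e m p w) (hi : i ≤ m) (hj : j ≤ m) :
    c (p i) = c (p j) ↔ i % 2 = j % 2 := by
  have := h.color_zero_ne
  have := h.color i hi
  have := h.color j hj
  grind

theorem color_ne_zero (h : E.IsAltWalk c e m p w) (hi : i ≤ m) : c (p i) ≠ 0 := by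
  rw [h.color i hi]
  split_ifs
  · exact h.color_zero_ne_zero
  · exact h.color_last_ne_zero

theorem length_mod_two (h : E.IsAltWalk c e m p w) : m % 2 = 1 := by
  by_contra hm
  have := h.color m le_rfl
  rw [h.edge_last, if_pos (by omega)] at this
  exact h.color_zero_ne this.symm

theorem color_eq_color_last_iff (h : E.IsAltWalk c e m p w) (hi : i ≤ m) :
    c (p i) = c e ↔ i % 2 = 1 := by
  rw [← h.length_mod_two, ← h.color_eq_iff hi le_rfl, h.edge_last]

theorem inc_succ (h : E.IsAltWalk c e m p w) (hi : i ≤ m) : E.Inc (p i) (w (i + 1)) := by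
  rw [h.vertex_succ i hi]
  exact inc_other (h.inc i hi)

theorem edge_eq_of_inc (h : E.IsAltWalk c e m p w) (hc : E.Proper c) (hi : i ≤ m) (hj : j ≤ m)
    (hij : i % 2 = j % 2) (hix : E.Inc (p i) x) (hjx : E.Inc (p j) x) : p i = p j :=
  hc _ (h.edge_lt i hi) _ (h.edge_lt j hj) x (h.color_ne_zero hi) ((h.color_eq_iff hi hj).2 hij)
    hix hjx

/-- At a coincidence `p i = p j`, the edge before the `j`-th one is adjacent to the `i`-th edge, so
it is the edge before or after the `i`-th one, which is an earlier coincidence. -/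
theorem edge_ne_of_lt (h : E.IsAltWalk c e m p w) (hE : E.Simple) (hc : E.Proper c) :
    ∀ j ≤ m, ∀ i < j, p i ≠ p j := by
  intro j
  induction j using Nat.strong_induction_on with
  | _ j ih =>
  intro hj i hij heq
  have hpar := (h.color_eq_iff (hij.le.trans hj) hj).1 (by rw [heq])
  obtain ⟨k, rfl⟩ : ∃ k, j = k + 1 := ⟨j - 1, by omega⟩
  have hk : E.Inc (p k) (w (k + 1)) := h.inc_succ (by omega)
  rcases eq_or_eq_other (h.inc i (by omega)) (heq ▸ h.inc _ hj) with hw | hw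
  · rw [hw] at hk
    rcases i with _ | i
    · refine h.edge_ne k (by omega) (hc _ (h.edge_lt k (by omega)) _ h.last_lt _
        (h.color_ne_zero (by omega)) ?_ hk (.inr h.vertex_zero.symm))
      exact (h.color_eq_color_last_iff (by omega)).2 (by omega)
    · exact ih k (by omega) (by omega) i (by omega)
        (h.edge_eq_of_inc hc (by omega) (by omega) (by omega) (h.inc_succ (by omega)) hk)
  · rw [← h.vertex_succ i (by omega)] at hw
    rw [hw] at hk
    have heq' : p (i + 1) = p k :=
      h.edge_eq_of_inc hc (by omega) (by omega) (by omega) (h.inc _ (by omega)) hk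
    rcases Nat.lt_or_ge (i + 1) k with hlt | hge
    · exact ih k (by omega) (by omega) (i + 1) hlt heq'
    · obtain rfl : k = i + 1 := by omega
      have := hE.other_ne (h.edge_lt (i + 1) (by omega)) (h.inc (i + 1) (by omega))
      rw [← h.vertex_succ (i + 1) (by omega)] at this
      exact this hw

theorem edge_injOn (h : E.IsAltWalk c e m p w) (hE : E.Simple) (hc : E.Proper c) :
    Set.InjOn p (Set.Iic m) := by
  intro i hi j hj hij
  rcases lt_trichotomy i j with hlt | heq | hgt
  · exact absurd hij (h.edge_ne_of_lt hE hc j hj i hlt)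
  · exact heq
  · exact absurd hij.symm (h.edge_ne_of_lt hE hc i hi j hgt)

theorem three_le (h : E.IsAltWalk c e m p w) (hE : E.Simple) : 3 ≤ m := by
  have hm := h.length_mod_two
  suffices m ≠ 1 by omega
  rintro rfl
  refine h.edge_ne 0 one_pos (hE.inj _ (h.edge_lt 0 zero_le_one) _ h.last_lt (w 0) (w 1) ?_
    (h.inc 0 zero_le_one) (h.inc_succ zero_le_one) (.inr h.vertex_zero.symm) ?_)
  · rw [h.vertex_succ 0 zero_le_one]
    exact (hE.other_ne (h.edge_lt 0 zero_le_one) (h.inc 0 zero_le_one)).symm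
  · rw [← h.edge_last]
    exact h.inc 1 le_rfl

theorem vertex_last (h : E.IsAltWalk c e m p w) (hE : E.Simple) (hc : E.Proper c) :
    w m = E.src e := by
  have hm := h.three_le hE
  have hpar := h.length_mod_two
  have hinc : E.Inc e (w m) := h.edge_last ▸ h.inc m le_rfl
  refine (hinc.resolve_right fun hdst => ?_).symm
  have hprev : E.Inc (p (m - 1)) (w m) := by
    have := h.inc_succ (i := m - 1) (by omega)
    rwa [Nat.sub_add_cancel (by omega)] at this
  have heq : p 0 = p (m - 1) := by
    refine h.edge_eq_of_inc hc (by omega) (by omega) (by omega) (h.inc 0 (by omega)) ?_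
    rwa [h.vertex_zero, hdst]
  have := h.edge_injOn hE hc (Set.mem_Iic.2 (by omega)) (Set.mem_Iic.2 (by omega)) heq
  omega

end IsAltWalk

end EdgeArray

/-! ### Undoing a round -/

namespace EdgeArray

/-- `c` results from `c₁` by uncoloring the edges `l[2], l[3], …`, and the list `l` records what is
needed to recover `c₁` from `c`: the colors along `l` have period two. -/
structure Undo (E : EdgeArray) (c₁ c : ℕ → ℕ) (l : List ℕ) : Prop where
  result : ∀ q, c q = if q ∈ l.drop 2 then 0 else c₁ q
  periodic : ∀ i (h : i + 2 < l.length), c₁ l[i + 2] = c₁ l[i]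
  keep : ∀ i (h : i < l.length), i < 2 → l[i] ∉ l.drop 2
  nodup : (l.drop 2).Nodup
  colored : ∀ q ∈ l.drop 2, q < E.size ∧ c₁ q ≠ 0

/-- The edge sequences of the walks with `d + 1` edges from `w` to `u`. -/
def walksTo (E : EdgeArray) (u : ℕ) : ℕ → ℕ → Finset (List ℕ)
  | w, 0 => {j ∈ E.star w | E.other j w = u}.image fun j => [j]
  | w, d + 1 => (E.star w).biUnion fun j => (E.walksTo u (E.other j w) d).image (List.cons j)

/-- The possible records of a round that colors `e` and uncolors `d` edges: the round succeeds, or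
an edge adjacent to `e` has the same color, or there is a two-colored cycle through `e`. -/
def recordsOfWeight (E : EdgeArray) (e : ℕ) : ℕ → Finset (List ℕ)
  | 0 => {[]}
  | 1 => (E.star (E.src e) ∪ E.star (E.dst e)).image fun f => [f, f, e]
  | d + 2 => (E.walksTo (E.src e) (E.dst e) (d + 2)).image (· ++ [e])

/-- The possible records of a round that colors `e`. -/
def records (E : EdgeArray) (e : ℕ) : Finset (List ℕ) :=
  (Finset.range (E.size + 1)).biUnion (E.recordsOfWeight e)

variable {E : EdgeArray} {c c₁ c₁' : ℕ → ℕ} {d e j u w m a Δ : ℕ} {l : List ℕ}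

theorem Undo.unique (h : E.Undo c₁ c l) (h' : E.Undo c₁' c l) : c₁ = c₁' := by
  have hkept : ∀ q ∉ l.drop 2, c₁ q = c₁' q := fun q hq => by
    have h1 := h.result q
    have h2 := h'.result q
    rw [if_neg hq] at h1 h2
    rw [← h1, h2]
  have hlist : ∀ i (hi : i < l.length), c₁ l[i] = c₁' l[i] := by
    intro i
    induction i using Nat.twoStepInduction with
    | zero => exact fun hi => hkept _ (h.keep 0 hi two_pos)
    | one => exact fun hi => hkept _ (h.keep 1 hi one_lt_two)
    | more i ih _ =>
      intro hi
      rw [h.periodic i hi, h'.periodic i hi]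
      exact ih (by omega)
  funext q
  by_cases hq : q ∈ l.drop 2
  · obtain ⟨i, hi, rfl⟩ := List.getElem_of_mem (List.mem_of_mem_drop hq)
    exact hlist i hi
  · exact hkept q hq

theorem length_of_mem_walksTo (h : l ∈ E.walksTo u w d) : l.length = d + 1 := by
  induction d generalizing w l with
  | zero =>
    obtain ⟨j, -, rfl⟩ := Finset.mem_image.1 h
    rfl
  | succ d ih =>
    simp only [walksTo, Finset.mem_biUnion, Finset.mem_image] at h
    obtain ⟨j, -, l', hl', rfl⟩ := h
    simp [ih hl']

theorem card_walksTo_le (hE : E.Simple) (hΔ : ∀ w, (E.star w).card ≤ Δ) :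
    (E.walksTo u w d).card ≤ Δ ^ d := by
  induction d generalizing w with
  | zero =>
    refine Finset.card_image_le.trans (Finset.card_le_one.2 fun i hi j hj => ?_)
    simp only [Finset.mem_filter, mem_star] at hi hj
    obtain ⟨⟨hi, hiw⟩, rfl⟩ := hi
    exact hE.inj i hi j hj.1.1 _ _ (hE.other_ne hi hiw) (inc_other hiw) hiw
      (hj.2 ▸ inc_other hj.1.2) hj.1.2
  | succ d ih =>
    rw [walksTo, pow_succ']
    exact (Finset.card_biUnion_le_card_mul _ _ (Δ ^ d) fun j _ =>
      Finset.card_image_le.trans ih).trans (Nat.mul_le_mul_right _ (hΔ w))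

theorem map_range_mem_walksTo {p w : ℕ → ℕ} (hlt : ∀ i ≤ d, p i < E.size)
    (hinc : ∀ i ≤ d, E.Inc (p i) (w i)) (hw : ∀ i ≤ d, w (i + 1) = E.other (p i) (w i)) :
    (List.range (d + 1)).map p ∈ E.walksTo (w (d + 1)) (w 0) d := by
  induction d generalizing p w with
  | zero =>
    refine Finset.mem_image.2 ⟨p 0, ?_, rfl⟩
    simp [mem_star, hlt 0 le_rfl, hinc 0 le_rfl, hw 0 le_rfl]
  | succ d ih =>
    have htail := ih (p := fun i => p (i + 1)) (w := fun i => w (i + 1))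
      (fun i hi => hlt _ (by omega)) (fun i hi => hinc _ (by omega)) (fun i hi => hw _ (by omega))
    simp only [zero_add, hw 0 (by omega)] at htail
    rw [List.range_succ_eq_map, List.map_cons, List.map_map, walksTo, Finset.mem_biUnion]
    exact ⟨p 0, mem_star.2 ⟨hlt 0 (by omega), hinc 0 (by omega)⟩,
      Finset.mem_image_of_mem _ htail⟩

theorem length_of_mem_recordsOfWeight (h : l ∈ E.recordsOfWeight e d) : l.length - 2 = d := by
  unfold recordsOfWeight at h
  split at h
  · rw [Finset.mem_singleton.1 h]
    rfl
  · obtain ⟨f, -, rfl⟩ := Finset.mem_image.1 h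
    rfl
  · obtain ⟨l', hl', rfl⟩ := Finset.mem_image.1 h
    simp [length_of_mem_walksTo hl']

theorem mem_records_of_mem_recordsOfWeight (hd : d ≤ E.size) (h : l ∈ E.recordsOfWeight e d) :
    l ∈ E.records e :=
  Finset.mem_biUnion.2 ⟨d, Finset.mem_range.2 (by omega), h⟩

theorem card_recordsOfWeight_mul_pow_le (hE : E.Simple) (hΔ : ∀ w, (E.star w).card ≤ Δ) {r : ℝ≥0}
    (hr : Δ * r ≤ 1 / 4) (d : ℕ) :
    (E.recordsOfWeight e d).card * r ^ d ≤ (1 / 4) ^ d + if d = 1 then 1 / 4 else 0 := by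
  unfold recordsOfWeight
  split
  · simp
  · have hcard : ((E.star (E.src e) ∪ E.star (E.dst e)).image fun f => [f, f, e]).card ≤ Δ + Δ :=
      Finset.card_image_le.trans ((Finset.card_union_le _ _).trans (add_le_add (hΔ _) (hΔ _)))
    calc _ ≤ ((Δ + Δ : ℕ) : ℝ≥0) * r ^ 1 := by gcongr
      _ = Δ * r + Δ * r := by push_cast; ring
      _ ≤ _ := by rw [if_pos rfl, pow_one]; gcongr
  · next d =>
    calc _ ≤ ((Δ ^ (d + 2) : ℕ) : ℝ≥0) * r ^ (d + 2) := by
          gcongr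
          exact Finset.card_image_le.trans (card_walksTo_le hE hΔ)
      _ = (Δ * r) ^ (d + 2) := by push_cast; ring
      _ ≤ (1 / 4) ^ (d + 2) := by gcongr
      _ ≤ _ := le_self_add

theorem sum_records_eq (r : ℝ≥0) : ∑ l ∈ E.records e, r ^ (l.length - 2) =
    ∑ d ∈ Finset.range (E.size + 1), (E.recordsOfWeight e d).card * r ^ d := by
  rw [records, Finset.sum_biUnion]
  · refine Finset.sum_congr rfl fun d _ => ?_
    rw [← nsmul_eq_mul, ← Finset.sum_const]
    exact Finset.sum_congr rfl fun l hl => by rw [length_of_mem_recordsOfWeight hl]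
  · refine fun d _ d' _ hne => Finset.disjoint_left.2 fun l hl hl' => hne ?_
    rw [← length_of_mem_recordsOfWeight hl, length_of_mem_recordsOfWeight hl']

theorem sum_records_le (hE : E.Simple) (hΔ : ∀ w, (E.star w).card ≤ Δ) {r : ℝ≥0}
    (hr : Δ * r ≤ 1 / 4) : ∑ l ∈ E.records e, r ^ (l.length - 2) ≤ 19 / 12 := by
  have hgeom : ∑ d ∈ Finset.range (E.size + 1), (1 / 4 : ℝ≥0) ^ d ≤ 4 / 3 := by
    rw [← NNReal.coe_le_coe]
    push_cast
    refine (Summable.sum_le_tsum _ (fun d _ => by positivity)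
      (summable_geometric_of_lt_one (by norm_num) (by norm_num))).trans_eq ?_
    rw [tsum_geometric_of_lt_one (by norm_num) (by norm_num)]
    norm_num
  calc ∑ l ∈ E.records e, r ^ (l.length - 2)
      ≤ ∑ d ∈ Finset.range (E.size + 1), ((1 / 4 : ℝ≥0) ^ d + if d = 1 then 1 / 4 else 0) := by
        rw [sum_records_eq]
        exact Finset.sum_le_sum fun d _ => card_recordsOfWeight_mul_pow_le hE hΔ hr d
    _ ≤ 4 / 3 + 1 / 4 := by
        rw [Finset.sum_add_distrib, Finset.sum_ite_eq']
        gcongr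
        split_ifs <;> simp
    _ = 19 / 12 := by norm_num

theorem mem_drop_map_range {p : ℕ → ℕ} {k q : ℕ} :
    q ∈ ((List.range (m + 1)).map p).drop k ↔ ∃ i, k ≤ i ∧ i ≤ m ∧ p i = q := by
  rw [List.mem_drop_iff_getElem]
  constructor
  · rintro ⟨i, hi, rfl⟩
    simp only [List.length_map, List.length_range] at hi
    exact ⟨k + i, by omega, by omega, by simp⟩
  · rintro ⟨i, h2, him, rfl⟩
    exact ⟨i - k, by simp; omega, by simp [Nat.add_sub_cancel' h2]⟩

namespace IsAltWalk

variable {p w : ℕ → ℕ}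

theorem map_range_mem_records (h : E.IsAltWalk c e m p w) (hE : E.Simple) (hc : E.Proper c)
    (hm : m ≤ E.size) : (List.range (m + 1)).map p ∈ E.records e := by
  have h3 := h.three_le hE
  obtain ⟨d, rfl⟩ : ∃ d, m = d + 2 + 1 := ⟨m - 3, by omega⟩
  refine mem_records_of_mem_recordsOfWeight (d := d + 2) (by omega) (Finset.mem_image.2
    ⟨(List.range (d + 2 + 1)).map p, ?_, by simp [List.range_succ, h.edge_last]⟩)
  rw [← h.vertex_zero, ← h.vertex_last hE hc]
  exact map_range_mem_walksTo (fun i hi => h.edge_lt i (by omega))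
    (fun i hi => h.inc i (by omega)) (fun i hi => h.vertex_succ i (by omega))

theorem undo (h : E.IsAltWalk c₁ e m p w) (hE : E.Simple) (hc : E.Proper c₁)
    (hres : ∀ q, c q = if q ∈ ((List.range (m + 1)).map p).drop 2 then 0 else c₁ q) :
    E.Undo c₁ c ((List.range (m + 1)).map p) where
  result := hres
  periodic i hi := by
    simp only [List.length_map, List.length_range] at hi
    simp only [List.getElem_map, List.getElem_range]
    exact (h.color_eq_iff (by omega) (by omega)).2 (by omega)
  keep i hi h2 hmem := by
    simp only [List.length_map, List.length_range] at hi
    simp only [List.getElem_map, List.getElem_range, mem_drop_map_range] at hmem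
    obtain ⟨k, hk2, hkm, hk⟩ := hmem
    have := h.edge_injOn hE hc (Set.mem_Iic.2 hkm) (Set.mem_Iic.2 (by omega)) hk
    omega
  nodup := by
    refine List.Nodup.sublist (List.drop_sublist _ _) ?_
    refine List.Nodup.map_on (fun a ha b hb hab => ?_) List.nodup_range
    rw [List.mem_range] at ha hb
    exact h.edge_injOn hE hc (Set.mem_Iic.2 (by omega)) (Set.mem_Iic.2 (by omega)) hab
  colored q hq := by
    obtain ⟨i, -, him, rfl⟩ := mem_drop_map_range.1 hq
    exact ⟨h.edge_lt i him, h.color_ne_zero him⟩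

end IsAltWalk

theorem uncolor_apply (hm : (E.trace c e j m).edge = e) (h2 : 2 ≤ m) (hmn : m ≤ E.size) (q : ℕ) :
    E.uncolor c e j q =
      if q ∈ ((List.range (m + 1)).map fun i => (E.trace c e j i).edge).drop 2 then 0
      else c q := by
  unfold uncolor
  congr 1
  rw [mem_drop_map_range, eq_iff_iff]
  constructor
  · rintro ⟨i, hi2, -, rfl⟩
    rcases le_total i m with him | him
    · exact ⟨i, hi2, him, rfl⟩
    · exact ⟨m, h2, le_rfl, by rw [trace_eq_of_edge_eq hm him]⟩
  · rintro ⟨i, hi2, him, rfl⟩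
    exact ⟨i, hi2, him.trans hmn, rfl⟩

theorem exists_undo_uncolor (hE : E.Simple) (hc : E.Proper c) (he : e < E.size) (hce : c e ≠ 0)
    (hj : j < E.size) (h : E.Closes c e j) :
    ∃ l ∈ E.records e, E.Undo c (E.uncolor c e j) l := by
  obtain ⟨m, hmn, hw⟩ := h.exists_isAltWalk hc he hce hj
  have h3 := hw.three_le hE
  exact ⟨_, hw.map_range_mem_records hE hc hmn,
    hw.undo hE hc (uncolor_apply hw.edge_last (by omega) hmn)⟩

theorem proper_update (hc : E.Proper c) (h : ∀ j < E.size, ¬ E.Conflict c e a j) :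
    E.Proper (Function.update c e a) := by
  have hfree : ∀ j < E.size, ∀ w, c j = a → E.Inc j w → ¬ E.Inc e w := by
    rintro j hj w hja hjw (rfl | rfl)
    · exact h j hj ⟨hja, .inl hjw⟩
    · exact h j hj ⟨hja, .inr hjw⟩
  intro i hi j hj w hi0 hij hiw hjw
  by_cases hie : i = e <;> by_cases hje : j = e
  · rw [hie, hje]
  · subst hie
    simp only [Function.update_self, Function.update_of_ne hje] at hij
    exact absurd hiw (hfree j hj w hij.symm hjw)
  · subst hje
    simp only [Function.update_self, Function.update_of_ne hie] at hij
    exact absurd hjw (hfree i hi w hij hiw)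
  · simp only [Function.update_of_ne hie, Function.update_of_ne hje] at hi0 hij
    exact hc i hi j hj w hi0 hij hiw hjw

theorem Proper.of_eq_zero_or_eq (hc : E.Proper c) (h : ∀ q, c₁ q = 0 ∨ c₁ q = c q) :
    E.Proper c₁ := by
  intro i hi j hj w hi0 hij hiw hjw
  have h1 := (h i).resolve_left hi0
  have h2 := (h j).resolve_left (by rwa [← hij])
  exact hc i hi j hj w (by rwa [← h1]) (by rw [← h1, hij, h2]) hiw hjw

theorem uncolor_eq_zero_or_eq (c : ℕ → ℕ) (e j q : ℕ) :
    E.uncolor c e j q = 0 ∨ E.uncolor c e j q = c q := by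
  unfold uncolor
  split_ifs <;> simp

theorem undo_conflict (he : e < E.size) (hce : c e = 0) (ha : a ≠ 0) (hj : E.Conflict c e a j) :
    E.Undo (Function.update c e a) c [j, j, e] := by
  have hne : j ≠ e := by
    rintro rfl
    exact ha (by rw [← hj.1, hce])
  refine ⟨fun q => ?_, fun i hi => ?_, fun i hi h2 => ?_, by simp, by simp [he, ha]⟩
  · by_cases hq : q = e <;> simp [hq, hce]
  · obtain rfl : i = 0 := Nat.lt_one_iff.1 (Nat.lt_of_add_lt_add_right hi)
    simp [hne, hj.1]
  · interval_cases i <;> simpa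

theorem exists_undo_round (hE : E.Simple) (hc : E.Proper c) (he : e < E.size) (hce : c e = 0)
    (ha : a ≠ 0) : ∃ l ∈ E.records e, E.Undo (Function.update c e a) (E.round c e a) l := by
  unfold round
  dsimp only
  split_ifs with hconflict hcloses
  · obtain ⟨f, hf, hfc⟩ := hconflict
    refine ⟨[f, f, e], mem_records_of_mem_recordsOfWeight (d := 1) (by omega)
      (Finset.mem_image_of_mem _ ?_), undo_conflict he hce ha hfc⟩
    simpa [mem_star, hf] using hfc.2
  · have hfirst := firstBelow_lt_iff.2 hcloses
    push Not at hconflict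
    exact exists_undo_uncolor hE (proper_update hc hconflict) he (by simpa) hfirst
      (firstBelow_spec hfirst)
  · exact ⟨[], mem_records_of_mem_recordsOfWeight (d := 0) (Nat.zero_le _) (by
      simp [recordsOfWeight]), ⟨by simp, by simp, by simp, by simp, by simp⟩⟩

theorem proper_round (hc : E.Proper c) : E.Proper (E.round c e a) := by
  unfold round
  dsimp only
  split_ifs with hconflict
  · exact hc
  all_goals push Not at hconflict
  · exact (proper_update hc hconflict).of_eq_zero_or_eq (uncolor_eq_zero_or_eq _ _ _)
  · exact proper_update hc hconflict

end EdgeArray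

/-! ### Cycles of simple graphs -/

open SimpleGraph in
theorem exists_isPath_of_mem_edges_of_isCycle {V : Type*} {G : SimpleGraph V} {u x y : V}
    {w : G.Walk u u} (hw : w.IsCycle) (hxy : s(x, y) ∈ w.edges) :
    ∃ r : G.Walk x y, r.IsPath ∧ ∀ f ∈ r.edges, f ∈ w.edges ∧ f ≠ s(x, y) := by
  classical
  have hedges : ∀ f ∈ w.edges, f ∈ (fromEdgeSet {f | f ∈ w.edges}).edgeSet := fun f hf => by
    rw [edgeSet_fromEdgeSet]
    exact ⟨hf, G.not_isDiag_of_mem_edgeSet (w.edges_subset_edgeSet hf)⟩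
  have hreach := adj_and_reachable_delete_edges_iff_exists_cycle.2
    ⟨u, w.transfer _ hedges, hw.transfer hedges, by rwa [Walk.edges_transfer]⟩
  obtain ⟨q, hq⟩ := hreach.2.exists_isPath
  have hqw : ∀ f ∈ q.edges, f ∈ w.edges ∧ f ≠ s(x, y) := fun f hf => by
    have := q.edges_subset_edgeSet hf
    rw [edgeSet_deleteEdges, edgeSet_fromEdgeSet] at this
    exact ⟨this.1.1, this.2⟩
  have hqG : ∀ f ∈ q.edges, f ∈ G.edgeSet := fun f hf => w.edges_subset_edgeSet (hqw f hf).1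
  exact ⟨q.transfer G hqG, hq.transfer hqG, by rwa [Walk.edges_transfer]⟩

namespace EdgeArray

/-- The edge array `E` is a list of the edges of the graph `G`, whose `i`-th edge is `ed i`. -/
structure Represents {v : ℕ} (E : EdgeArray) (G : SimpleGraph (Fin v))
    (ed : Fin E.size ≃ G.edgeSet) : Prop where
  inc_iff : ∀ (i : Fin E.size) (x : Fin v), E.Inc i x ↔ x ∈ (ed i : Sym2 (Fin v))
  src_lt : ∀ i : Fin E.size, E.src i < v
  dst_lt : ∀ i : Fin E.size, E.dst i < v

/-- Every cycle of `G` has an edge whose color is neither of two given ones. This holds for a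
partial coloring, since an uncolored edge will do, and it is an invariant of the algorithm. -/
def NoBichromaticCycle {v : ℕ} (E : EdgeArray) (G : SimpleGraph (Fin v))
    (ed : Fin E.size ≃ G.edgeSet) (c : ℕ → ℕ) : Prop :=
  ∀ a b, a ≠ 0 → b ≠ 0 → ∀ (u : Fin v) (w : G.Walk u u), w.IsCycle →
    ∃ i : Fin E.size, (ed i : Sym2 (Fin v)) ∈ w.edges ∧ c i ≠ a ∧ c i ≠ b

variable {v : ℕ} {E : EdgeArray} {G : SimpleGraph (Fin v)} {ed : Fin E.size ≃ G.edgeSet}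
  {c c' : ℕ → ℕ} {e : Fin E.size} {x y : Fin v} {a : ℕ}

theorem Represents.lt_of_inc (hR : E.Represents G ed) {i : Fin E.size} {w : ℕ} (h : E.Inc i w) :
    w < v := by
  rcases h with rfl | rfl
  · exact hR.src_lt i
  · exact hR.dst_lt i

theorem Represents.eq_mk (hR : E.Represents G ed) {i : Fin E.size} (hxy : x ≠ y)
    (hx : E.Inc i x) (hy : E.Inc i y) : (ed i : Sym2 (Fin v)) = s(x, y) :=
  (Sym2.mem_and_mem_iff hxy).1 ⟨(hR.inc_iff i x).1 hx, (hR.inc_iff i y).1 hy⟩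

theorem Represents.src_ne_dst (hR : E.Represents G ed) (i : Fin E.size) : E.src i ≠ E.dst i := by
  intro h
  obtain ⟨f, hf⟩ : ∃ f, ed i = f := ⟨_, rfl⟩
  obtain ⟨⟨x, y⟩, hxy⟩ := f
  have hx : E.Inc i x := (hR.inc_iff i x).2 (by simp [hf])
  have hy : E.Inc i y := (hR.inc_iff i y).2 (by simp [hf])
  refine G.ne_of_adj hxy (Fin.ext (show (x : ℕ) = y from ?_))
  unfold Inc at hx hy
  omega

theorem Represents.simple (hR : E.Represents G ed) : E.Simple where
  loopless i hi := hR.src_ne_dst ⟨i, hi⟩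
  inj i hi j hj w w' hne hiw hiw' hjw hjw' := by
    have hw := hR.lt_of_inc (i := ⟨i, hi⟩) hiw
    have hw' := hR.lt_of_inc (i := ⟨i, hi⟩) hiw'
    have hne' : (⟨w, hw⟩ : Fin v) ≠ ⟨w', hw'⟩ := by simpa using hne
    have heq := (hR.eq_mk (i := ⟨i, hi⟩) hne' hiw hiw').trans
      (hR.eq_mk (i := ⟨j, hj⟩) hne' hjw hjw').symm
    exact Fin.mk.inj (ed.injective (Subtype.ext heq))

theorem Represents.exists_inc_of_adj (hR : E.Represents G ed) (h : G.Adj x y) :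
    ∃ i : Fin E.size, (ed i : Sym2 (Fin v)) = s(x, y) ∧ E.Inc i x ∧ E.Inc i y ∧
      E.other i x = y := by
  obtain ⟨i, hi⟩ := ed.surjective ⟨s(x, y), h⟩
  have hx : E.Inc i x := (hR.inc_iff i x).2 (by simp [hi])
  have hy : E.Inc i y := (hR.inc_iff i y).2 (by simp [hi])
  refine ⟨i, by rw [hi], hx, hy, ((eq_or_eq_other hx hy).resolve_left fun h' => ?_).symm⟩
  exact h.ne (Fin.ext h'.symm)

theorem NoBichromaticCycle.of_eq_zero_or_eq (h : E.NoBichromaticCycle G ed c)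
    (hle : ∀ q, c' q = 0 ∨ c' q = c q) : E.NoBichromaticCycle G ed c' := by
  intro a b ha hb u w hw
  obtain ⟨i, hi, hia, hib⟩ := h a b ha hb u w hw
  refine ⟨i, hi, ?_⟩
  rcases hle i with h0 | h0 <;> rw [h0]
  · exact ⟨ha.symm, hb.symm⟩
  · exact ⟨hia, hib⟩

theorem advance_eq_of_inc (hc : E.Proper c) {i : ℕ} {s : WalkPos} (hi : i < E.size)
    (hci : c i = s.next) (hnext : s.next ≠ 0) (hinc : E.Inc i s.vertex) (hs : s.edge ≠ e) :
    E.advance c e s = ⟨i, E.other i s.vertex, c s.edge⟩ := by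
  have hfirst : firstBelow E.size (fun j => c j = s.next ∧ E.Inc j s.vertex) = i :=
    firstBelow_eq hi ⟨hci, hinc⟩ fun k hk h => hk.ne <|
      hc k (hk.trans hi) i hi _ (by rwa [h.1]) (by rw [h.1, hci]) h.2 hinc
  simp [advance, hfirst, hs, hi]

theorem iterate_advance_edge_of_isPath (hR : E.Represents G ed) (hc : E.Proper c)
    (hy : E.Inc e y) (q : G.Walk x y) (hq : q.IsPath) (heq : (ed e : Sym2 (Fin v)) ∉ q.edges)
    (p : Fin E.size) (b : ℕ) (hp : E.Inc p x) (hpe : p ≠ e)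
    (hpq : (ed p : Sym2 (Fin v)) ∉ q.edges) (hcp : c p ≠ 0) (hb : b ≠ 0)
    (hcol : ∀ i, (ed i : Sym2 (Fin v)) ∈ q.edges → c i = b ∨ c i = c p)
    (he : c e = b ∨ c e = c p) :
    ((E.advance c e)^[q.length + 1] ⟨p, x, b⟩).edge = e := by
  have hpe' : (p : ℕ) ≠ e := fun h => hpe (Fin.ext h)
  have eq_of_color {i : Fin E.size} {z : ℕ} (hi : c i = c p) (hiz : E.Inc i z)
      (hpz : E.Inc p z) : p = i :=
    Fin.ext (hc p p.2 i i.2 z hcp hi.symm hpz hiz)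
  induction q generalizing p b with
  | nil =>
    have heb : c e = b := he.resolve_right fun h => hpe (eq_of_color h hy hp)
    rw [SimpleGraph.Walk.length_nil, zero_add, Function.iterate_one,
      advance_eq_of_inc (s := ⟨p, _, b⟩) hc e.2 heb hb hy hpe']
  | @cons x x' y h q ih =>
    rw [SimpleGraph.Walk.cons_isPath_iff] at hq
    simp only [SimpleGraph.Walk.edges_cons, List.mem_cons, not_or] at hpq heq hcol
    obtain ⟨i, hi, hix, hix', hother⟩ := hR.exists_inc_of_adj h
    have hib : c i = b := (hcol i (.inl hi)).resolve_right fun h =>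
      hpq.1 (by rw [eq_of_color h hix hp, hi])
    have hie : i ≠ e := by
      rintro rfl
      exact heq.1 hi
    rw [SimpleGraph.Walk.length_cons, Function.iterate_succ_apply,
      advance_eq_of_inc (s := ⟨p, x, b⟩) hc i.2 hib hb hix hpe', hother]
    refine ih hy hq.1 heq.2 i (c p) hix' hie ?_ (hib ▸ hb) hcp
      (fun k hk => (hib ▸ hcol k (.inr hk)).symm) (hib ▸ he.symm) (fun h => hie (Fin.ext h)) ?_
    · rw [hi]
      exact fun hmem => hq.2 (SimpleGraph.Walk.fst_mem_support_of_mem_edges _ hmem)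
    · exact fun {j z} hj hjz hiz => Fin.ext (hc i i.2 j j.2 z (hib ▸ hb) hj.symm hiz hjz)

theorem length_le_of_isPath (ed : Fin E.size ≃ G.edgeSet) {q : G.Walk x y}
    (hq : q.IsPath) : q.length ≤ E.size := by
  let := Fintype.ofEquiv _ ed
  calc q.length ≤ G.edgeFinset.card := hq.isTrail.length_le_card_edgeFinset
    _ = Fintype.card G.edgeSet := Set.toFinset_card _
    _ = E.size := by rw [← Fintype.card_congr ed, Fintype.card_fin]

/-- The walk from `e` over the end `x` of `e` follows every two-colored path that joins the ends of
`e`. -/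
theorem exists_closes_of_isPath (hR : E.Represents G ed) (hc : E.Proper c) (hx : E.dst e = x)
    (hy : E.src e = y) {b : ℕ} (hb : b ≠ 0) (he : c e ≠ 0) {q : G.Walk x y} (hq : q.IsPath)
    (heq : (ed e : Sym2 (Fin v)) ∉ q.edges)
    (hcol : ∀ i, (ed i : Sym2 (Fin v)) ∈ q.edges → c i = c e ∨ c i = b) :
    ∃ j < E.size, E.Closes c e j := by
  have hlen := length_le_of_isPath ed hq
  cases q with
  | nil => exact absurd (hy.trans hx.symm) (hR.src_ne_dst e)
  | @cons _ x' _ hadj q =>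
    rw [SimpleGraph.Walk.cons_isPath_iff] at hq
    simp only [SimpleGraph.Walk.edges_cons, List.mem_cons, not_or] at heq hcol
    obtain ⟨j, hj, hjx, hjx', hother⟩ := hR.exists_inc_of_adj hadj
    have hje : j ≠ e := by
      rintro rfl
      exact heq.1 hj
    have hjb : c j = b := (hcol j (.inl hj)).resolve_left fun h =>
      hje (Fin.ext (hc j j.2 e e.2 x (h ▸ he) h hjx (.inr hx)))
    have hjq : (ed j : Sym2 (Fin v)) ∉ q.edges := fun hmem =>
      hq.2 (SimpleGraph.Walk.fst_mem_support_of_mem_edges _ (hj ▸ hmem))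
    have hreturn : (E.trace c e j (q.length + 1)).edge = e := by
      rw [trace, hx, hother]
      exact iterate_advance_edge_of_isPath hR hc (.inl hy) q hq.1 heq.2 j (c e) hjx' hje hjq
        (hjb ▸ hb) he (fun i hi => hjb ▸ hcol i (.inr hi)) (.inl rfl)
    refine ⟨j, j.2, hjb ▸ hb, fun h => hje (Fin.ext h), hx ▸ hjx, ?_⟩
    rw [trace_eq_of_edge_eq hreturn hlen, hreturn]

theorem noBichromaticCycle_update (hR : E.Represents G ed) (h : E.NoBichromaticCycle G ed c)
    (hc : E.Proper (Function.update c e a))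
    (hcloses : ∀ j < E.size, ¬ E.Closes (Function.update c e a) e j) :
    E.NoBichromaticCycle G ed (Function.update c e a) := by
  intro a' b' ha' hb' u w hw
  by_cases hew : (ed e : Sym2 (Fin v)) ∈ w.edges
  · by_contra! hcon
    generalize Function.update c (e : ℕ) a = c' at *
    obtain ⟨b, hb, hcol⟩ : ∃ b ≠ 0, ∀ i, (ed i : Sym2 (Fin v)) ∈ w.edges →
        c' i = c' e ∨ c' i = b := by
      by_cases he : c' e = a'
      · exact ⟨b', hb', fun i hi => he ▸ or_iff_not_imp_left.2 (hcon i hi)⟩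
      · exact ⟨a', ha', fun i hi => hcon e hew he ▸ (or_iff_not_imp_left.2 (hcon i hi)).symm⟩
    have he : c' e ≠ 0 := fun h0 => hb' (h0 ▸ (hcon e hew (h0 ▸ ha'.symm)).symm)
    let x : Fin v := ⟨E.dst e, hR.dst_lt e⟩
    let y : Fin v := ⟨E.src e, hR.src_lt e⟩
    have hed : (ed e : Sym2 (Fin v)) = s(x, y) :=
      hR.eq_mk (fun h => hR.src_ne_dst e (Fin.mk.inj h).symm) (.inr rfl) (.inl rfl)
    obtain ⟨q, hq, hqw⟩ := exists_isPath_of_mem_edges_of_isCycle hw (hed ▸ hew)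
    obtain ⟨j, hj, hje⟩ := exists_closes_of_isPath hR hc (x := x) rfl (y := y) rfl hb he hq
      (fun hmem => (hqw _ hmem).2 hed) fun i hi => hcol i (hqw _ hi).1
    exact hcloses j hj hje
  · obtain ⟨i, hi, hia, hib⟩ := h a' b' ha' hb' u w hw
    have hie : (i : ℕ) ≠ e := fun h' => hew (Fin.ext h' ▸ hi)
    rw [← Function.update_of_ne hie a c] at hia hib
    exact ⟨i, hi, hia, hib⟩

theorem uncolor_update_eq_zero_or_eq (hE : E.Simple) (hc : E.Proper (Function.update c e a))
    (ha : a ≠ 0) {j : ℕ} (hj : j < E.size) (h : E.Closes (Function.update c e a) e j) (q : ℕ) :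
    E.uncolor (Function.update c e a) e j q = 0 ∨
      E.uncolor (Function.update c e a) e j q = c q := by
  by_cases hq : q = e
  · subst hq
    obtain ⟨m, hmn, hw⟩ := h.exists_isAltWalk hc e.2 (by simpa) hj
    exact .inl (if_pos ⟨m, (Nat.le_succ 2).trans (hw.three_le hE), hmn, hw.edge_last⟩)
  · rw [← Function.update_of_ne hq a c]
    exact uncolor_eq_zero_or_eq _ _ _ _

theorem noBichromaticCycle_round (hR : E.Represents G ed) (hc : E.Proper c)
    (h : E.NoBichromaticCycle G ed c) (ha : a ≠ 0) :
    E.NoBichromaticCycle G ed (E.round c e a) := by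
  unfold round
  dsimp only
  split_ifs with hconflict hcloses
  · exact h
  all_goals push Not at hconflict
  · have hfirst := firstBelow_lt_iff.2 hcloses
    exact h.of_eq_zero_or_eq (uncolor_update_eq_zero_or_eq hR.simple (proper_update hc hconflict)
      ha hfirst (firstBelow_spec hfirst))
  · push Not at hcloses
    exact noBichromaticCycle_update hR h (proper_update hc hconflict) hcloses

theorem Represents.noBichromaticCycle_zero (hR : E.Represents G ed) :
    E.NoBichromaticCycle G ed (fun _ => 0) := by
  intro a b ha hb u w hw
  cases w with
  | nil => exact absurd hw SimpleGraph.Walk.not_isCycle_nil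
  | cons h w =>
    obtain ⟨i, hi, -⟩ := hR.exists_inc_of_adj h
    exact ⟨i, by simp [hi], ha.symm, hb.symm⟩

theorem isAcyclicEdgeColoring_of_forall_eq (hR : E.Represents G ed) (hc : E.Proper c)
    (h : E.NoBichromaticCycle G ed c) {M : ℕ} {C : G.EdgeLabeling (Fin M)}
    (hC : ∀ i, C (ed i) + 1 = c i) : G.IsAcyclicEdgeColoring C where
  proper f g hne := by
    rintro ⟨x, hx, hx'⟩ heq
    obtain ⟨i, rfl⟩ := ed.surjective f
    obtain ⟨j, rfl⟩ := ed.surjective g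
    refine hne (congrArg ed (Fin.ext (hc i i.2 j j.2 x ?_ ?_ ((hR.inc_iff i x).2 hx)
      ((hR.inc_iff j x).2 hx'))))
    · rw [← hC]
      exact Nat.succ_ne_zero _
    · rw [← hC, ← hC, heq]
  acyclic u w hw := by
    have hne (i : Fin E.size) : c i ≠ 0 := by
      rw [← hC]
      exact Nat.succ_ne_zero _
    have hC' {i j : Fin E.size} (hij : c i ≠ c j) : C (ed i) ≠ C (ed j) := fun heq =>
      hij (by rw [← hC, heq, hC])
    obtain ⟨i₁, hi₁, -, -⟩ := h 1 1 one_ne_zero one_ne_zero u w hw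
    obtain ⟨i₂, hi₂, h12, -⟩ := h _ _ (hne i₁) (hne i₁) u w hw
    obtain ⟨i₃, hi₃, h13, h23⟩ := h _ _ (hne i₁) (hne i₂) u w hw
    rw [← (Set.toFinite _).cast_ncard_eq]
    refine Nat.cast_lt.2 ((Set.two_lt_ncard (Set.toFinite _)).2 ?_)
    exact ⟨_, ⟨ed i₁, hi₁, rfl⟩, _, ⟨ed i₂, hi₂, rfl⟩, _, ⟨ed i₃, hi₃, rfl⟩,
      hC' h12.symm, hC' h13.symm, hC' h23.symm⟩

theorem exists_isAcyclicEdgeColoring (hR : E.Represents G ed) (hc : E.Proper c)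
    (h : E.NoBichromaticCycle G ed c) {M : ℕ} (h0 : ∀ i < E.size, c i ≠ 0)
    (hM : ∀ i < E.size, c i ≤ M) :
    ∃ C : G.EdgeLabeling (Fin M), G.IsAcyclicEdgeColoring C ∧ ∀ i, (C (ed i) : ℕ) = c i - 1 := by
  have hlt (i : Fin E.size) : c i - 1 < M :=
    (Nat.sub_lt (Nat.pos_of_ne_zero (h0 i i.2)) one_pos).trans_le (hM i i.2)
  let C : G.EdgeLabeling (Fin M) := fun f => ⟨c (ed.symm f) - 1, hlt _⟩
  have hC (i) : (C (ed i) : ℕ) = c i - 1 := by simp [C]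
  refine ⟨C, isAcyclicEdgeColoring_of_forall_eq hR hc h fun i => ?_, hC⟩
  rw [hC, Nat.sub_add_cancel (Nat.pos_of_ne_zero (h0 i i.2))]

end EdgeArray

/-! ### Independent coins -/

namespace RandRAM

open MeasureTheory ProbabilityTheory

instance : IsProbabilityMeasure coinMeasure := by
  unfold coinMeasure
  infer_instance

section Coins

variable {m : ℕ} {s : Set (ℕ → Bool)}

theorem exists_preimage_of_dependsOn (hs : DependsOn (· ∈ s) (Set.Iio m)) :
    ∃ t : Set (Finset.range m → Bool), s = (fun ω (i : Finset.range m) => ω i) ⁻¹' t := by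
  refine ⟨(fun ω (i : Finset.range m) => ω i) '' s, Set.Subset.antisymm
    (Set.subset_preimage_image _ _) ?_⟩
  rintro ω ⟨ω', hω', h⟩
  refine (iff_of_eq (hs fun i hi => ?_)).1 hω'
  exact congrFun h ⟨i, Finset.mem_range.2 hi⟩

theorem measurableSet_of_dependsOn (hs : DependsOn (· ∈ s) (Set.Iio m)) : MeasurableSet s := by
  obtain ⟨t, rfl⟩ := exists_preimage_of_dependsOn hs
  exact (measurable_pi_lambda _ fun i => measurable_pi_apply _) t.toFinite.measurableSet

theorem coinMeasure_eval_eq (m : ℕ) (b : Bool) : coinMeasure {ω | ω m = b} = 2⁻¹ := by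
  have h := (measurePreserving_eval_infinitePi
    (fun _ : ℕ => (PMF.uniformOfFintype Bool).toMeasure) m).measure_preimage
    (measurableSet_singleton b).nullMeasurableSet
  rw [PMF.toMeasure_apply_singleton _ _ (measurableSet_singleton b),
    PMF.uniformOfFintype_apply] at h
  change coinMeasure {ω | ω m = b} = _ at h
  simpa using h

theorem coinMeasure_inter_eval_eq (hs : DependsOn (· ∈ s) (Set.Iio m)) (b : Bool) :
    coinMeasure (s ∩ {ω | ω m = b}) = coinMeasure s * 2⁻¹ := by
  obtain ⟨t, rfl⟩ := exists_preimage_of_dependsOn hs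
  have hcoins : iIndepFun (fun (i : ℕ) (ω : ℕ → Bool) => ω i) coinMeasure :=
    iIndepFun_infinitePi (P := fun _ : ℕ => (PMF.uniformOfFintype Bool).toMeasure)
      (X := fun _ b => b) (fun _ => measurable_id)
  have hindep := hcoins.indepFun_finset (Finset.range m) {m} (by simp) measurable_pi_apply
  rw [← coinMeasure_eval_eq m b]
  exact hindep.measure_inter_preimage_eq_mul t {f | f ⟨m, by simp⟩ = b}
    t.toFinite.measurableSet (Set.toFinite _).measurableSet

end Coins

/-- The number whose binary digits, from the most significant one on, are the `k` coins
`m, …, m + k - 1`. -/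
def bits (ω : ℕ → Bool) (m : ℕ) : ℕ → ℕ
  | 0 => 0
  | k + 1 => bits ω m k + bits ω m k + (ω (m + k)).toNat

theorem bits_lt (ω : ℕ → Bool) (m k : ℕ) : bits ω m k < 2 ^ k := by
  induction k with
  | zero => simp [bits]
  | succ k ih =>
    have := Bool.toNat_le (ω (m + k))
    rw [bits, pow_succ]
    lia

theorem dependsOn_bits (m k : ℕ) : DependsOn (bits · m k) (Set.Iio (m + k)) := by
  intro ω ω' h
  induction k with
  | zero => rfl
  | succ k ih =>
    dsimp only at ih ⊢
    rw [bits, bits, ih fun i hi => h i (Nat.lt_succ_of_lt hi), h (m + k) (Nat.lt_succ_self _)]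

theorem coinMeasure_inter_bits_le {m : ℕ} {s : Set (ℕ → Bool)}
    (hs : DependsOn (· ∈ s) (Set.Iio m)) (k x : ℕ) :
    coinMeasure (s ∩ {ω | bits ω m k = x}) ≤ coinMeasure s * 2⁻¹ ^ k := by
  induction k generalizing x with
  | zero => simpa using measure_mono Set.inter_subset_left
  | succ k ih =>
    have hdep : DependsOn (· ∈ s ∩ {ω | bits ω m k = x / 2}) (Set.Iio (m + k)) := by
      intro ω ω' h
      have hbits := dependsOn_bits m k h
      have hmem := hs fun i hi => h i (Nat.lt_add_right k hi)
      simp_all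
    have hsub : s ∩ {ω | bits ω m (k + 1) = x} ⊆
        (s ∩ {ω | bits ω m k = x / 2}) ∩ {ω | ω (m + k) = decide (x % 2 = 1)} := by
      rintro ω ⟨hω, hx : bits ω m (k + 1) = x⟩
      rw [bits] at hx
      refine ⟨⟨hω, ?_⟩, ?_⟩ <;> rcases hb : ω (m + k) <;> simp [hb] at hx ⊢ <;> lia
    calc coinMeasure (s ∩ {ω | bits ω m (k + 1) = x})
        ≤ coinMeasure (s ∩ {ω | bits ω m k = x / 2}) * 2⁻¹ :=
          (measure_mono hsub).trans (coinMeasure_inter_eval_eq hdep _).le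
      _ ≤ coinMeasure s * 2⁻¹ ^ k * 2⁻¹ := by
          gcongr
          exact ih _
      _ = coinMeasure s * 2⁻¹ ^ (k + 1) := by rw [pow_succ, mul_assoc]

end RandRAM

/-! ### The expected number of rounds -/

namespace EdgeArray

open MeasureTheory RandRAM

variable {E : EdgeArray} {K : ℕ} {c : ℕ → ℕ} {S : Finset ℕ}

/-- The set of colored edges. -/
def supp (E : EdgeArray) (c : ℕ → ℕ) : Finset ℕ := {j ∈ Finset.range E.size | c j ≠ 0}

/-- The least edge outside `S`, which is the edge colored next if `S` is the set of colored edges;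
it is the junk value `E.size` if `S` contains all edges. -/
def next (E : EdgeArray) (S : Finset ℕ) : ℕ := firstBelow E.size (· ∉ S)

theorem mem_supp {j : ℕ} : j ∈ E.supp c ↔ j < E.size ∧ c j ≠ 0 := by simp [supp]

theorem next_supp : E.next (E.supp c) = firstBelow E.size (c · = 0) :=
  firstBelow_congr fun j hj => by simp [mem_supp, hj]

theorem supp_ssubset_iff : E.supp c ⊂ Finset.range E.size ↔ ∃ j < E.size, c j = 0 := by
  simp [ssubset_iff_subset_ne, supp, Finset.filter_eq_self]

theorem next_lt (hS : S ⊂ Finset.range E.size) : E.next S < E.size := by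
  obtain ⟨j, hj, hjS⟩ := Finset.exists_of_ssubset hS
  exact firstBelow_lt_iff.2 ⟨j, Finset.mem_range.1 hj, hjS⟩

theorem next_notMem (hS : S ⊂ Finset.range E.size) : E.next S ∉ S :=
  firstBelow_spec (P := (· ∉ S)) (next_lt hS)

theorem apply_next_supp (h : E.next (E.supp c) < E.size) : c (E.next (E.supp c)) = 0 := by
  rw [next_supp] at h ⊢
  exact firstBelow_spec (P := (c · = 0)) h

/-- The coloring after `t` rounds of the algorithm with `2 ^ k` colors: every round gives a color
determined by `k` fresh coins to the least uncolored edge, and does nothing if there is none. -/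
def process (E : EdgeArray) (k : ℕ) (ω : ℕ → Bool) : ℕ → ℕ → ℕ
  | 0 => fun _ => 0
  | t + 1 =>
    let c := E.process k ω t
    if E.next (E.supp c) < E.size then E.round c (E.next (E.supp c)) (bits ω (k * t) k + 1) else c

/-- A proper partial coloring of the edges with the colors `1, …, K`. -/
structure IsPartial (E : EdgeArray) (K : ℕ) (c : ℕ → ℕ) : Prop where
  le : ∀ i, c i ≤ K
  zero : ∀ i, E.size ≤ i → c i = 0
  proper : E.Proper c

theorem IsPartial.round (h : E.IsPartial K c) (hE : E.Simple) {e a : ℕ} (he : e < E.size)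
    (hce : c e = 0) (ha : a ≠ 0) (haK : a ≤ K) : E.IsPartial K (E.round c e a) := by
  obtain ⟨l, -, hundo⟩ := exists_undo_round hE h.proper he hce ha
  refine ⟨fun i => ?_, fun i hi => ?_, proper_round h.proper⟩ <;> rw [hundo.result] <;> split_ifs
  · exact Nat.zero_le _
  · rw [Function.update_apply]
    split_ifs
    · exact haK
    · exact h.le i
  · rfl
  · rw [Function.update_of_ne (he.trans_le hi).ne', h.zero i hi]

theorem isPartial_process (hE : E.Simple) (k : ℕ) (ω : ℕ → Bool) (t : ℕ) :
    E.IsPartial (2 ^ k) (E.process k ω t) := by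
  induction t with
  | zero => exact ⟨fun _ => Nat.zero_le _, fun _ _ => rfl, fun i _ j _ w h => absurd rfl h⟩
  | succ t ih =>
    rw [process]
    split_ifs with h
    · exact ih.round hE h (apply_next_supp h) (Nat.succ_ne_zero _) (bits_lt _ _ _)
    · exact ih

theorem dependsOn_process (E : EdgeArray) (k t : ℕ) :
    DependsOn (E.process k · t) (Set.Iio (k * t)) := by
  intro ω ω' h
  induction t with
  | zero => rfl
  | succ t ih =>
    dsimp only at ih ⊢
    have hbits : bits ω (k * t) k = bits ω' (k * t) k := dependsOn_bits (k * t) k h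
    rw [process, process, ih fun i hi => h i (Nat.lt_add_right k hi), hbits]

/-- The pairs of a set of colored edges and the record of a round that starts with this set. -/
def moves (E : EdgeArray) : Finset ((_ : Finset ℕ) × List ℕ) :=
  (Finset.range E.size).ssubsets.sigma fun S => {l ∈ E.records (E.next S) |
    (l.drop 2).Nodup ∧ (l.drop 2).toFinset ⊆ insert (E.next S) S}

/-- The set of colored edges after a move. -/
def outcome (E : EdgeArray) (x : (_ : Finset ℕ) × List ℕ) : Finset ℕ :=
  insert (E.next x.1) x.1 \ (x.2.drop 2).toFinset

/-- If `A S` bounds the probability of every single coloring of the edges in `S` before a round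
with `K` colors, then `E.push K A S` does so after the round. -/
def push (E : EdgeArray) (K : ℕ) (A : Finset ℕ → ℝ≥0) (S : Finset ℕ) : ℝ≥0 :=
  (∑ x ∈ E.moves with E.outcome x = S, A x.1) / K

theorem mem_insert_next_supp {a : ℕ} (h : E.next (E.supp c) < E.size) (ha : a ≠ 0) {j : ℕ} :
    j ∈ insert (E.next (E.supp c)) (E.supp c) ↔
      j < E.size ∧ Function.update c (E.next (E.supp c)) a j ≠ 0 := by
  rw [Finset.mem_insert, mem_supp]
  by_cases hj : j = E.next (E.supp c)
  · simp [← hj, hj ▸ h, ha]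
  · simp [hj]

theorem Undo.mem_moves {a : ℕ} {c' : ℕ → ℕ} {l : List ℕ} (ha : a ≠ 0)
    (h : E.next (E.supp c) < E.size) (hl : l ∈ E.records (E.next (E.supp c)))
    (hundo : E.Undo (Function.update c (E.next (E.supp c)) a) c' l) :
    ⟨E.supp c, l⟩ ∈ E.moves ∧ E.outcome ⟨E.supp c, l⟩ = E.supp c' := by
  constructor
  · rw [moves, Finset.mem_sigma, Finset.mem_ssubsets, supp_ssubset_iff, Finset.mem_filter]
    exact ⟨⟨_, h, apply_next_supp h⟩, hl, hundo.nodup, fun j hj =>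
      (mem_insert_next_supp h ha).2 (hundo.colored j (List.mem_toFinset.1 hj))⟩
  · ext j
    rw [outcome, Finset.mem_sdiff, mem_insert_next_supp h ha, mem_supp, hundo.result,
      List.mem_toFinset]
    by_cases hj : j ∈ l.drop 2 <;> simp [hj]

/-- A record determines the coloring and the random color before the round from the coloring after
it, so that each record contributes at most one elementary event. -/
theorem measure_undo_le {k t : ℕ} {p : ℝ≥0∞} {S : Finset ℕ} (hS : S ⊂ Finset.range E.size)
    (hp : ∀ c, E.supp c = S → coinMeasure {ω | E.process k ω t = c} ≤ p)
    (c : ℕ → ℕ) (l : List ℕ) :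
    coinMeasure {ω | E.supp (E.process k ω t) = S ∧
      E.Undo (Function.update (E.process k ω t) (E.next S) (bits ω (k * t) k + 1)) c l} ≤
      p * 2⁻¹ ^ k := by
  set V := {ω | E.supp (E.process k ω t) = S ∧
    E.Undo (Function.update (E.process k ω t) (E.next S) (bits ω (k * t) k + 1)) c l}
  rcases V.eq_empty_or_nonempty with hV | ⟨ω₀, h₀, hundo₀⟩
  · simp [hV]
  have hzero {c' : ℕ → ℕ} (h : E.supp c' = S) : c' (E.next S) = 0 := by
    subst h
    exact apply_next_supp (next_lt hS)
  have hsub : V ⊆ {ω | E.process k ω t = E.process k ω₀ t} ∩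
      {ω | bits ω (k * t) k = bits ω₀ (k * t) k} := by
    rintro ω ⟨h, hundo⟩
    have hupdate := hundo.unique hundo₀
    refine ⟨?_, by simpa using congrFun hupdate (E.next S)⟩
    calc E.process k ω t = Function.update (E.process k ω t) (E.next S) 0 := by
          rw [← hzero h, Function.update_eq_self]
      _ = Function.update (E.process k ω₀ t) (E.next S) 0 := by
          simpa using congrArg (Function.update · (E.next S) 0) hupdate
      _ = E.process k ω₀ t := by rw [← hzero h₀, Function.update_eq_self]
  have hdep : DependsOn (· ∈ {ω | E.process k ω t = E.process k ω₀ t}) (Set.Iio (k * t)) :=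
    fun ω ω' h => congrArg (· = E.process k ω₀ t) (dependsOn_process E k t h)
  calc coinMeasure V ≤ coinMeasure {ω | E.process k ω t = E.process k ω₀ t} * 2⁻¹ ^ k :=
        (measure_mono hsub).trans (coinMeasure_inter_bits_le hdep _ _)
    _ ≤ p * 2⁻¹ ^ k := by
        gcongr
        exact hp _ h₀

theorem measure_process_succ_le (hE : E.Simple) {k t : ℕ} {A : Finset ℕ → ℝ≥0}
    (hA : ∀ c, E.supp c ⊂ Finset.range E.size →
      coinMeasure {ω | E.process k ω t = c} ≤ A (E.supp c))
    (c : ℕ → ℕ) (hc : E.supp c ⊂ Finset.range E.size) :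
    coinMeasure {ω | E.process k ω (t + 1) = c} ≤ E.push (2 ^ k) A (E.supp c) := by
  set M := {x ∈ E.moves | E.outcome x = E.supp c}
  set V : (_ : Finset ℕ) × List ℕ → Set (ℕ → Bool) := fun x => {ω | E.supp (E.process k ω t) = x.1 ∧
    E.Undo (Function.update (E.process k ω t) (E.next x.1) (bits ω (k * t) k + 1)) c x.2}
  have hcover : {ω | E.process k ω (t + 1) = c} ⊆ ⋃ x ∈ M, V x := by
    rintro ω rfl
    by_cases h : E.next (E.supp (E.process k ω t)) < E.size
    · obtain ⟨l, hl, hundo⟩ := exists_undo_round hE (isPartial_process hE k ω t).proper h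
        (apply_next_supp h) (Nat.succ_ne_zero (bits ω (k * t) k))
      have hround : E.process k ω (t + 1) = _ := if_pos h
      rw [← hround] at hundo
      exact Set.mem_biUnion (Finset.mem_coe.2 (Finset.mem_filter.2
        (hundo.mem_moves (Nat.succ_ne_zero _) h hl))) ⟨rfl, hundo⟩
    · have hsame : E.process k ω (t + 1) = E.process k ω t := if_neg h
      rw [hsame] at hc
      exact absurd (next_lt hc) h
  have hV : ∀ x ∈ M, coinMeasure (V x) ≤ A x.1 * 2⁻¹ ^ k := fun x hx => by
    have hx := (Finset.mem_sigma.1 (Finset.mem_filter.1 hx).1).1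
    exact measure_undo_le (Finset.mem_ssubsets.1 hx)
      (fun c hcx => hcx ▸ hA c (hcx ▸ Finset.mem_ssubsets.1 hx)) c x.2
  calc coinMeasure {ω | E.process k ω (t + 1) = c}
      ≤ ∑ x ∈ M, coinMeasure (V x) := (measure_mono hcover).trans (measure_biUnion_finset_le _ _)
    _ ≤ ∑ x ∈ M, (A x.1 : ℝ≥0∞) * 2⁻¹ ^ k := Finset.sum_le_sum hV
    _ = E.push (2 ^ k) A (E.supp c) := by
        rw [push, ENNReal.coe_div (by positivity), div_eq_mul_inv, ← Finset.sum_mul]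
        simp [ENNReal.inv_pow, M]

theorem outcome_subset {x : (_ : Finset ℕ) × List ℕ} (hx : x ∈ E.moves) :
    E.outcome x ⊆ Finset.range E.size := by
  have hS := Finset.mem_ssubsets.1 (Finset.mem_sigma.1 hx).1
  exact Finset.sdiff_subset.trans
    (Finset.insert_subset (Finset.mem_range.2 (next_lt hS)) hS.subset)

theorem card_outcome_add {x : (_ : Finset ℕ) × List ℕ} (hx : x ∈ E.moves) :
    (E.outcome x).card + (x.2.length - 2) = x.1.card + 1 := by
  obtain ⟨hS, hl⟩ := Finset.mem_sigma.1 hx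
  obtain ⟨-, hnodup, hsub⟩ := Finset.mem_filter.1 hl
  rw [outcome, ← Finset.card_insert_of_notMem (next_notMem (Finset.mem_ssubsets.1 hS)),
    ← List.length_drop, ← List.toFinset_card_of_nodup hnodup]
  exact Finset.card_sdiff_add_card_eq_card hsub

theorem measure_supp_eq_le (hE : E.Simple) {k t : ℕ} {p : ℝ≥0}
    (hp : ∀ c, E.supp c = S → coinMeasure {ω | E.process k ω t = c} ≤ p) :
    coinMeasure {ω | E.supp (E.process k ω t) = S} ≤ ((2 ^ k) ^ S.card * p : ℝ≥0) := by
  set F := Fintype.piFinset fun _ : S => Finset.Icc 1 (2 ^ k)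
  set V : (S → ℕ) → Set (ℕ → Bool) := fun g =>
    {ω | E.supp (E.process k ω t) = S ∧ ∀ i : S, E.process k ω t i = g i}
  have hcover : {ω | E.supp (E.process k ω t) = S} ⊆ ⋃ g ∈ F, V g := fun ω h => by
    have hcolored (i : S) : E.process k ω t i ≠ 0 := (mem_supp.1 ((Finset.ext_iff.1 h i).2 i.2)).2
    exact Set.mem_biUnion (x := fun i : S => E.process k ω t i) (Fintype.mem_piFinset.2 fun i =>
      Finset.mem_Icc.2 ⟨Nat.one_le_iff_ne_zero.2 (hcolored i), (isPartial_process hE k ω t).le i⟩)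
      ⟨h, fun _ => rfl⟩
  have hV (g : S → ℕ) : coinMeasure (V g) ≤ p := by
    rcases (V g).eq_empty_or_nonempty with hVg | ⟨ω₀, h₀, hg₀⟩
    · simp [hVg]
    refine (measure_mono ?_).trans (hp _ h₀)
    rintro ω ⟨h, hg⟩
    funext i
    by_cases hi : i ∈ S
    · exact (hg ⟨i, hi⟩).trans (hg₀ ⟨i, hi⟩).symm
    · have hzero {ω : ℕ → Bool} (h : E.supp (E.process k ω t) = S) : E.process k ω t i = 0 := by
        by_contra hne
        have hiE := not_le.1 (mt ((isPartial_process hE k ω t).zero i) hne)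
        exact hi (h ▸ mem_supp.2 ⟨hiE, hne⟩)
      exact (hzero h).trans (hzero h₀).symm
  calc coinMeasure {ω | E.supp (E.process k ω t) = S}
      ≤ ∑ g ∈ F, coinMeasure (V g) := (measure_mono hcover).trans (measure_biUnion_finset_le _ _)
    _ ≤ F.card • (p : ℝ≥0∞) := Finset.sum_le_card_nsmul _ _ _ fun g _ => hV g
    _ = ((2 ^ k) ^ S.card * p : ℝ≥0) := by simp [F]

section Potential

variable {Δ H : ℕ}

theorem sum_moves_le (hE : E.Simple) (hΔ : ∀ w, (E.star w).card ≤ Δ) (hH : 0 < H)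
    (hΔH : 4 * Δ ≤ H) (A : Finset ℕ → ℝ≥0) :
    ∑ x ∈ E.moves, (H : ℝ≥0) ^ (E.outcome x).card * A x.1 ≤
      19 / 12 * H * ∑ S ∈ (Finset.range E.size).powerset, (H : ℝ≥0) ^ S.card * A S := by
  have hH' : (H : ℝ≥0) ≠ 0 := Nat.cast_ne_zero.2 hH.ne'
  have hratio : (Δ : ℝ≥0) * (H : ℝ≥0)⁻¹ ≤ 1 / 4 := by
    rw [← div_eq_mul_inv, div_le_div_iff₀ (by positivity) (by norm_num)]
    exact_mod_cast by lia
  have hpow : ∀ x ∈ E.moves, (H : ℝ≥0) ^ (E.outcome x).card =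
      H ^ (x.1.card + 1) * (H : ℝ≥0)⁻¹ ^ (x.2.length - 2) := fun x hx => by
    rw [← card_outcome_add hx, pow_add, mul_assoc, ← mul_pow, mul_inv_cancel₀ hH', one_pow, mul_one]
  calc ∑ x ∈ E.moves, (H : ℝ≥0) ^ (E.outcome x).card * A x.1
      = ∑ x ∈ E.moves, H ^ (x.1.card + 1) * A x.1 * (H : ℝ≥0)⁻¹ ^ (x.2.length - 2) :=
        Finset.sum_congr rfl fun x hx => by rw [hpow x hx, mul_right_comm]
    _ ≤ ∑ S ∈ (Finset.range E.size).ssubsets, ∑ l ∈ E.records (E.next S),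
          H ^ (S.card + 1) * A S * (H : ℝ≥0)⁻¹ ^ (l.length - 2) := by
        rw [moves, Finset.sum_sigma]
        gcongr
        exact Finset.filter_subset _ _
    _ ≤ ∑ S ∈ (Finset.range E.size).ssubsets, H ^ (S.card + 1) * A S * (19 / 12) := by
        simp only [← Finset.mul_sum]
        gcongr
        exact sum_records_le hE hΔ hratio
    _ ≤ ∑ S ∈ (Finset.range E.size).powerset, H ^ (S.card + 1) * A S * (19 / 12) := by
        gcongr
        exact Finset.erase_subset _ _
    _ = 19 / 12 * H * ∑ S ∈ (Finset.range E.size).powerset, (H : ℝ≥0) ^ S.card * A S := by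
        rw [Finset.mul_sum]
        exact Finset.sum_congr rfl fun S _ => by ring

theorem sum_push_le (hE : E.Simple) (hΔ : ∀ w, (E.star w).card ≤ Δ) (hH : 0 < H)
    (hΔH : 4 * Δ ≤ H) (A : Finset ℕ → ℝ≥0) :
    ∑ S ∈ (Finset.range E.size).powerset, (H : ℝ≥0) ^ S.card * E.push (2 * H) A S ≤
      19 / 24 * ∑ S ∈ (Finset.range E.size).powerset, (H : ℝ≥0) ^ S.card * A S := by
  calc ∑ S ∈ (Finset.range E.size).powerset, (H : ℝ≥0) ^ S.card * E.push (2 * H) A S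
      = (∑ S ∈ (Finset.range E.size).powerset, ∑ x ∈ E.moves with E.outcome x = S,
          (H : ℝ≥0) ^ (E.outcome x).card * A x.1) / (2 * H : ℕ) := by
        rw [Finset.sum_div]
        refine Finset.sum_congr rfl fun S _ => ?_
        rw [push, mul_div_assoc', Finset.mul_sum]
        congr 1
        exact Finset.sum_congr rfl fun x hx => by rw [(Finset.mem_filter.1 hx).2]
    _ = (∑ x ∈ E.moves, (H : ℝ≥0) ^ (E.outcome x).card * A x.1) / (2 * H : ℕ) := by
        rw [Finset.sum_fiberwise_of_maps_to fun x hx => Finset.mem_powerset.2 (outcome_subset hx)]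
    _ ≤ (19 / 12 * H * ∑ S ∈ (Finset.range E.size).powerset, (H : ℝ≥0) ^ S.card * A S) /
          (2 * H : ℕ) := by
        gcongr
        exact sum_moves_le hE hΔ hH hΔH A
    _ = 19 / 24 * ∑ S ∈ (Finset.range E.size).powerset, (H : ℝ≥0) ^ S.card * A S := by
        push_cast
        field_simp
        ring

theorem exists_measure_process_le (hE : E.Simple) (hΔ : ∀ w, (E.star w).card ≤ Δ) (hH : 0 < H)
    (hΔH : 4 * Δ ≤ H) {k : ℕ} (hk : 2 ^ k = 2 * H) (t : ℕ) :
    ∃ A : Finset ℕ → ℝ≥0,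
      (∀ c, E.supp c ⊂ Finset.range E.size →
        coinMeasure {ω | E.process k ω t = c} ≤ A (E.supp c)) ∧
      ∑ S ∈ (Finset.range E.size).powerset, (H : ℝ≥0) ^ S.card * A S ≤ (19 / 24) ^ t := by
  induction t with
  | zero =>
    refine ⟨Pi.single ∅ 1, fun c _ => ?_, by simp [Pi.single_apply]⟩
    by_cases hc : (fun _ => 0) = c
    · simpa [← hc, supp] using prob_le_one
    · simp [process, hc]
  | succ t ih =>
    obtain ⟨A, hA, hsum⟩ := ih
    refine ⟨E.push (2 ^ k) A, measure_process_succ_le hE hA, ?_⟩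
    rw [hk, pow_succ']
    refine (sum_push_le hE hΔ hH hΔH A).trans ?_
    gcongr

theorem measure_incomplete_le (hE : E.Simple) (hΔ : ∀ w, (E.star w).card ≤ Δ) (hH : 0 < H)
    (hΔH : 4 * Δ ≤ H) {k : ℕ} (hk : 2 ^ k = 2 * H) (t : ℕ) :
    coinMeasure {ω | E.supp (E.process k ω t) ⊂ Finset.range E.size} ≤
      (2 ^ E.size * (19 / 24) ^ t : ℝ≥0) := by
  obtain ⟨A, hA, hsum⟩ := exists_measure_process_le hE hΔ hH hΔH hk t
  have hcover : {ω | E.supp (E.process k ω t) ⊂ Finset.range E.size} ⊆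
      ⋃ S ∈ (Finset.range E.size).ssubsets, {ω | E.supp (E.process k ω t) = S} :=
    fun ω h => Set.mem_biUnion (Finset.mem_coe.2 (Finset.mem_ssubsets.2 h)) rfl
  have hweight : ∀ S ∈ (Finset.range E.size).ssubsets,
      coinMeasure {ω | E.supp (E.process k ω t) = S} ≤
        (2 ^ E.size * ((H : ℝ≥0) ^ S.card * A S) : ℝ≥0) := fun S hS => by
    rw [Finset.mem_ssubsets] at hS
    refine (measure_supp_eq_le hE fun c hc => hc ▸ hA c (hc ▸ hS)).trans (ENNReal.coe_le_coe.2 ?_)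
    have hK : (2 : ℝ≥0) ^ k = 2 * H := by exact_mod_cast hk
    rw [hK, mul_pow, mul_assoc]
    gcongr
    · exact one_le_two
    · exact (Finset.card_le_card hS.subset).trans_eq (Finset.card_range _)
  calc coinMeasure {ω | E.supp (E.process k ω t) ⊂ Finset.range E.size}
      ≤ ∑ S ∈ (Finset.range E.size).ssubsets, coinMeasure {ω | E.supp (E.process k ω t) = S} :=
        (measure_mono hcover).trans (measure_biUnion_finset_le _ _)
    _ ≤ (∑ S ∈ (Finset.range E.size).ssubsets, 2 ^ E.size * ((H : ℝ≥0) ^ S.card * A S) : ℝ≥0) := by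
        push_cast
        exact_mod_cast Finset.sum_le_sum hweight
    _ ≤ (2 ^ E.size * (19 / 24) ^ t : ℝ≥0) := by
        rw [← Finset.mul_sum, ENNReal.coe_le_coe]
        gcongr
        exact (Finset.sum_le_sum_of_subset (Finset.erase_subset _ _)).trans hsum

theorem tsum_measure_incomplete_le (hE : E.Simple) (hΔ : ∀ w, (E.star w).card ≤ Δ) (hH : 0 < H)
    (hΔH : 4 * Δ ≤ H) {k : ℕ} (hk : 2 ^ k = 2 * H) :
    ∑' t, coinMeasure {ω | E.supp (E.process k ω t) ⊂ Finset.range E.size} ≤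
      (3 * E.size + 5 : ℕ) := by
  have htail (t : ℕ) :
      coinMeasure {ω | E.supp (E.process k ω (t + 3 * E.size)) ⊂ Finset.range E.size} ≤
        ((19 / 24 : ℝ≥0) : ℝ≥0∞) ^ t := by
    refine (measure_incomplete_le hE hΔ hH hΔH hk _).trans ?_
    rw [← ENNReal.coe_pow, ENNReal.coe_le_coe, pow_add, pow_mul, mul_left_comm, ← mul_pow]
    refine mul_le_of_le_one_right' (pow_le_one₀ zero_le ?_)
    rw [← NNReal.coe_le_coe]
    norm_num
  rw [← ENNReal.summable.sum_add_tsum_nat_add' (k := 3 * E.size), Nat.cast_add]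
  refine add_le_add ?_ ?_
  · simpa using Finset.sum_le_card_nsmul (Finset.range (3 * E.size)) _ _ fun _ _ => prob_le_one
  · refine (ENNReal.tsum_le_tsum htail).trans ?_
    rw [ENNReal.tsum_geometric, ← ENNReal.coe_one, ← ENNReal.coe_sub, ENNReal.inv_le_iff_inv_le,
      ← ENNReal.coe_natCast, ← ENNReal.coe_inv (by norm_num), ENNReal.coe_le_coe,
      ← NNReal.coe_le_coe, NNReal.coe_sub (by rw [← NNReal.coe_le_coe]; norm_num)]
    norm_num

end Potential

end EdgeArray

/-! ### Programs over named variables -/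

namespace RandRAM

section Runs

/-- In at most `T` steps the program `P` turns the memory `s` into `s'`, whatever remains to be
executed afterwards. -/
def Runs (ω : ℕ → Bool) (P : Cmd) (s s' : State) (T : ℕ) : Prop :=
  ∃ t ≤ T, ∀ K, (step ω)^[t] ⟨P :: K, s⟩ = ⟨K, s'⟩

namespace Runs

variable {ω : ℕ → Bool} {P Q : Cmd} {s s' s'' : State} {r T T' : ℕ}

theorem of_step (h : ∀ K, step ω ⟨P :: K, s⟩ = ⟨K, s'⟩) : Runs ω P s s' 1 :=
  ⟨1, le_rfl, h⟩

theorem seq (h : Runs ω P s s' T) (h' : Runs ω Q s' s'' T') :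
    Runs ω (.seq P Q) s s'' (1 + T + T') := by
  obtain ⟨t, ht, h⟩ := h
  obtain ⟨t', ht', h'⟩ := h'
  refine ⟨t' + (t + 1), by omega, fun K => ?_⟩
  rw [Function.iterate_add_apply, Function.iterate_succ_apply]
  simp only [step]
  rw [h, h']

theorem ite_pos (hr : s.reg r ≠ 0) (h : Runs ω P s s' T) :
    Runs ω (.ite r P Q) s s' (1 + T + T') := by
  obtain ⟨t, ht, h⟩ := h
  refine ⟨t + 1, by omega, fun K => ?_⟩
  rw [Function.iterate_succ_apply]
  simp only [step, if_pos hr]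
  rw [h]

theorem ite_neg (hr : s.reg r = 0) (h : Runs ω Q s s' T') :
    Runs ω (.ite r P Q) s s' (1 + T + T') := by
  obtain ⟨t, ht, h⟩ := h
  refine ⟨t + 1, by omega, fun K => ?_⟩
  rw [Function.iterate_succ_apply]
  simp only [step, hr, ne_eq, not_true_eq_false, if_false]
  rw [h]

theorem loop_done (hr : s.reg r = 0) : Runs ω (.loop r P) s s 1 :=
  of_step fun K => by simp [step, hr]

theorem loop_more (hr : s.reg r ≠ 0) (h : Runs ω P s s' T)
    (h' : Runs ω (.loop r P) s' s'' T') : Runs ω (.loop r P) s s'' (1 + T + T') := by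
  obtain ⟨t, ht, h⟩ := h
  obtain ⟨t', ht', h'⟩ := h'
  refine ⟨t' + (t + 1), by omega, fun K => ?_⟩
  rw [Function.iterate_add_apply, Function.iterate_succ_apply]
  simp only [step, if_pos hr]
  rw [h, h']

end Runs

end Runs

section Language

/-- The variables of the algorithm. -/
inductive Var : Type
  | i | j | k | acc | edge | pending | color | bit | level
  | walkEdge | walkVertex | walkNext | succ | closing
  deriving DecidableEq

/-- The arrays of the algorithm, in the order of their numbers on the machine. -/
inductive Arr : Type
  | src | dst | out | color | trace
  deriving DecidableEq

/-- The values of the variables and of the arrays, and the number of coins used so far. -/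
@[ext]
structure Store : Type where
  var : Var → ℕ
  arr : Arr → ℕ → ℕ
  used : ℕ

/-- Put `x` into the variable `v`. -/
def Store.setVar (σ : Store) (v : Var) (x : ℕ) : Store :=
  { σ with var := Function.update σ.var v x }

/-- Put `x` into cell `i` of the array `A`. -/
def Store.setArr (σ : Store) (A : Arr) (i x : ℕ) : Store :=
  { σ with arr := Function.update σ.arr A (Function.update (σ.arr A) i x) }

/-- Arithmetic expressions. Here `size` is the number of edges, `cond a b c` is `b` if `a` is not
zero and `c` otherwise, and `fold v w a b` starts with the value `a` of `w` and replaces it by the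
value of `b` for `v = size - 1, …, 1, 0`. The variables `v` and `w` are local to `fold`. -/
inductive Expr : Type
  | size : Expr
  | const (k : ℕ) : Expr
  | var (v : Var) : Expr
  | add (a b : Expr) : Expr
  | sub (a b : Expr) : Expr
  | read (A : Arr) (a : Expr) : Expr
  | cond (a b c : Expr) : Expr
  | fold (v w : Var) (a b : Expr) : Expr

/-- The value of an expression when there are `n` edges. -/
def Expr.eval (n : ℕ) : Expr → Store → ℕ
  | size, _ => n
  | const k, _ => k
  | var v, σ => σ.var v
  | add a b, σ => a.eval n σ + b.eval n σ
  | sub a b, σ => a.eval n σ - b.eval n σ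
  | read A a, σ => σ.arr A (a.eval n σ)
  | cond a b c, σ => if a.eval n σ ≠ 0 then b.eval n σ else c.eval n σ
  | fold v w a b, σ =>
    n.foldRev (fun j _ x => b.eval n ((σ.setVar w x).setVar v j)) (a.eval n σ)

/-- Programs whose loops are all counted: `forDown v p` runs `p` for `v = size - 1, …, 1, 0` and
then restores `v`. -/
inductive Prog : Type
  | skip : Prog
  | assign (v : Var) (a : Expr) : Prog
  | write (A : Arr) (a b : Expr) : Prog
  | flip (v : Var) : Prog
  | seq (p q : Prog) : Prog
  | ite (a : Expr) (p q : Prog) : Prog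
  | forDown (v : Var) (p : Prog) : Prog

/-- The effect of a program when there are `n` edges. -/
def Prog.den (ω : ℕ → Bool) (n : ℕ) : Prog → Store → Store
  | skip, σ => σ
  | assign v a, σ => σ.setVar v (a.eval n σ)
  | write A a b, σ => σ.setArr A (a.eval n σ) (b.eval n σ)
  | flip v, σ => { σ.setVar v (ω σ.used).toNat with used := σ.used + 1 }
  | seq p q, σ => q.den ω n (p.den ω n σ)
  | ite a p q, σ => if a.eval n σ ≠ 0 then p.den ω n σ else q.den ω n σ
  | forDown v p, σ =>
    (n.foldRev (fun j _ τ => p.den ω n (τ.setVar v j)) σ).setVar v (σ.var v)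

end Language

section Compilation

/-- The register that holds the variable `v`. -/
def varReg (v : Var) : ℕ := 2 * v.ctorIdx + 2

/-- The `d`-th register of the stack of intermediate values. -/
def stackReg (d : ℕ) : ℕ := 2 * d + 3

/-- Push the value of an expression onto a stack of height `d`. -/
def Expr.compile : Expr → ℕ → Cmd
  | size, d => .copy (stackReg d) 1
  | const k, d => .const (stackReg d) k
  | var v, d => .copy (stackReg d) (varReg v)
  | add a b, d =>
    .seq (a.compile d) <| .seq (b.compile (d + 1)) <|
      .add (stackReg d) (stackReg d) (stackReg (d + 1))
  | sub a b, d =>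
    .seq (a.compile d) <| .seq (b.compile (d + 1)) <|
      .sub (stackReg d) (stackReg d) (stackReg (d + 1))
  | read A a, d => .seq (a.compile d) <| .load (stackReg d) A.ctorIdx (stackReg d)
  | cond a b c, d => .seq (a.compile d) <| .ite (stackReg d) (b.compile d) (c.compile d)
  | fold v w a b, d =>
    .seq (.copy (stackReg d) (varReg v)) <| .seq (.copy (stackReg (d + 1)) (varReg w)) <|
    .seq (a.compile (d + 2)) <| .seq (.copy (varReg w) (stackReg (d + 2))) <|
    .seq (.copy (stackReg (d + 2)) 1) <|
    .seq (.loop (stackReg (d + 2)) <|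
      .seq (.const (stackReg (d + 3)) 1) <|
      .seq (.sub (stackReg (d + 2)) (stackReg (d + 2)) (stackReg (d + 3))) <|
      .seq (.copy (varReg v) (stackReg (d + 2))) <|
      .seq (b.compile (d + 3)) <| .copy (varReg w) (stackReg (d + 3))) <|
    .seq (.copy (stackReg (d + 2)) (varReg w)) <|
    .seq (.copy (varReg w) (stackReg (d + 1))) <| .seq (.copy (varReg v) (stackReg d)) <|
    .copy (stackReg d) (stackReg (d + 2))

/-- Translation of a program that leaves a stack of height `d` alone. -/
def Prog.compile : Prog → ℕ → Cmd
  | skip, _ => .skip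
  | assign v a, d => .seq (a.compile d) <| .copy (varReg v) (stackReg d)
  | write A a b, d =>
    .seq (a.compile d) <| .seq (b.compile (d + 1)) <|
      .store A.ctorIdx (stackReg d) (stackReg (d + 1))
  | flip v, _ => .flip (varReg v)
  | seq p q, d => .seq (p.compile d) (q.compile d)
  | ite a p q, d => .seq (a.compile d) <| .ite (stackReg d) (p.compile d) (q.compile d)
  | forDown v p, d =>
    .seq (.copy (stackReg d) (varReg v)) <| .seq (.copy (stackReg (d + 1)) 1) <|
    .seq (.loop (stackReg (d + 1)) <|
      .seq (.const (stackReg (d + 2)) 1) <|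
      .seq (.sub (stackReg (d + 1)) (stackReg (d + 1)) (stackReg (d + 2))) <|
      .seq (.copy (varReg v) (stackReg (d + 1))) <| p.compile (d + 2)) <|
    .copy (varReg v) (stackReg d)

/-- A bound for the number of steps of a program whose loops have at most `X` iterations. -/
def cost : Cmd → Polynomial ℕ
  | .seq P Q => 1 + cost P + cost Q
  | .ite _ P Q => 1 + cost P + cost Q
  | .loop _ P => Polynomial.X * (1 + cost P) + 1
  | _ => 1

/-- The stack in the registers holds the numbers in the list, the first of which is its top. -/
def HoldsStack (reg : ℕ → ℕ) : List ℕ → Prop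
  | [] => True
  | x :: l => reg (stackReg l.length) = x ∧ HoldsStack reg l

/-- The memory `s` represents the store `σ` with the intermediate values `l`. -/
structure Encodes (n : ℕ) (σ : Store) (l : List ℕ) (s : State) : Prop where
  size : s.reg 1 = n
  var : ∀ v, s.reg (varReg v) = σ.var v
  arr : ∀ A : Arr, s.arr A.ctorIdx = σ.arr A
  used : s.used = σ.used
  stack : HoldsStack s.reg l

theorem varReg_injective : Function.Injective varReg := by
  intro v w h
  have : v.ctorIdx = w.ctorIdx := by
    unfold varReg at h
    omega
  cases v <;> cases w <;> first | rfl | cases this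

theorem Arr.ctorIdx_injective : Function.Injective Arr.ctorIdx := by
  intro A B h
  cases A <;> cases B <;> first | rfl | cases h

theorem varReg_ne_stackReg (v : Var) (d : ℕ) : varReg v ≠ stackReg d := by
  unfold varReg stackReg
  omega

theorem holdsStack_congr {reg reg' : ℕ → ℕ} {l : List ℕ}
    (h : ∀ d < l.length, reg' (stackReg d) = reg (stackReg d)) (hl : HoldsStack reg l) :
    HoldsStack reg' l := by
  induction l with
  | nil => trivial
  | cons x l ih =>
    exact ⟨(h _ (by simp)).trans hl.1, ih (fun d hd => h d (hd.trans (by simp))) hl.2⟩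

theorem HoldsStack.apply {reg : ℕ → ℕ} {x : ℕ} {l l' : List ℕ} (h : HoldsStack reg (l' ++ x :: l)) :
    reg (stackReg l.length) = x := by
  induction l' with
  | nil => exact h.1
  | cons y l' ih => exact ih h.2

namespace Encodes

variable {n x : ℕ} {σ : Store} {l : List ℕ} {s : State}

theorem push (h : Encodes n σ l s) (x : ℕ) :
    Encodes n σ (x :: l) (s.setReg (stackReg l.length) x) where
  size := by simpa [State.setReg, stackReg] using h.size
  var v := by simpa [State.setReg, varReg_ne_stackReg] using h.var v
  arr := h.arr
  used := h.used
  stack := by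
    refine ⟨by simp [State.setReg], holdsStack_congr (fun d hd => ?_) h.stack⟩
    simp [State.setReg, stackReg, hd.ne]

theorem pop (h : Encodes n σ (x :: l) s) : Encodes n σ l s :=
  { h with stack := h.stack.2 }

theorem setVar (h : Encodes n σ l s) (v : Var) (x : ℕ) :
    Encodes n (σ.setVar v x) l (s.setReg (varReg v) x) where
  size := by simpa [State.setReg, varReg] using h.size
  var w := by
    simp [State.setReg, Store.setVar, Function.update_apply, varReg_injective.eq_iff, h.var]
  arr := h.arr
  used := h.used
  stack := holdsStack_congr
    (fun d _ => by simp [State.setReg, (varReg_ne_stackReg v d).symm]) h.stack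

theorem setArr (h : Encodes n σ l s) (A : Arr) (i x : ℕ) :
    Encodes n (σ.setArr A i x) l (s.setArr A.ctorIdx i x) where
  size := h.size
  var := h.var
  arr B := by
    simp [State.setArr, Store.setArr, Function.update_apply, Arr.ctorIdx_injective.eq_iff, h.arr]
  used := h.used
  stack := h.stack

end Encodes

/-- With `n` edges and coins `ω`, the program `P` takes the store `σ` with the stack `l` to the
store `σ'` with the stack `l'`. -/
def Exec (ω : ℕ → Bool) (n : ℕ) (P : Cmd) (σ : Store) (l : List ℕ) (σ' : Store) (l' : List ℕ) :
    Prop :=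
  ∀ s, Encodes n σ l s → ∃ s', Runs ω P s s' ((cost P).eval n) ∧ Encodes n σ' l' s'

namespace Exec

variable {ω : ℕ → Bool} {n x y k : ℕ} {v w : Var} {P Q : Cmd} {σ σ' σ'' : Store} {l l' l'' : List ℕ}

theorem seq (h : Exec ω n P σ l σ' l') (h' : Exec ω n Q σ' l' σ'' l'') :
    Exec ω n (.seq P Q) σ l σ'' l'' := by
  intro s hs
  obtain ⟨s', hrun, hs'⟩ := h s hs
  obtain ⟨s'', hrun', hs''⟩ := h' s' hs'
  exact ⟨s'', by simpa [cost] using hrun.seq hrun', hs''⟩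

theorem of_step (hP : cost P = 1) (f : State → State)
    (hstep : ∀ s K, step ω ⟨P :: K, s⟩ = ⟨K, f s⟩)
    (h : ∀ s, Encodes n σ l s → Encodes n σ' l' (f s)) : Exec ω n P σ l σ' l' :=
  fun s hs => ⟨f s, by simpa [hP] using Runs.of_step (hstep s), h s hs⟩

theorem push_const : Exec ω n (.const (stackReg l.length) k) σ l σ (k :: l) :=
  of_step rfl _ (fun _ _ => rfl) fun _ h => h.push k

theorem push_size : Exec ω n (.copy (stackReg l.length) 1) σ l σ (n :: l) :=
  of_step rfl _ (fun _ _ => rfl) fun _ h => by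
    rw [h.size]
    exact h.push n

theorem push_var : Exec ω n (.copy (stackReg l.length) (varReg v)) σ l σ (σ.var v :: l) :=
  of_step rfl _ (fun _ _ => rfl) fun _ h => by
    rw [h.var]
    exact h.push _

theorem add : Exec ω n (.add (stackReg l.length) (stackReg l.length) (stackReg (l.length + 1)))
    σ (y :: x :: l) σ ((x + y) :: l) :=
  of_step rfl _ (fun _ _ => rfl) fun s h => by
    obtain ⟨hy, hx, -⟩ := h.stack
    rw [hx, show s.reg (stackReg (l.length + 1)) = y from hy]
    exact h.pop.pop.push _

theorem sub : Exec ω n (.sub (stackReg l.length) (stackReg l.length) (stackReg (l.length + 1)))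
    σ (y :: x :: l) σ ((x - y) :: l) :=
  of_step rfl _ (fun _ _ => rfl) fun s h => by
    obtain ⟨hy, hx, -⟩ := h.stack
    rw [hx, show s.reg (stackReg (l.length + 1)) = y from hy]
    exact h.pop.pop.push _

theorem load {A : Arr} : Exec ω n (.load (stackReg l.length) A.ctorIdx (stackReg l.length))
    σ (x :: l) σ (σ.arr A x :: l) :=
  of_step rfl _ (fun _ _ => rfl) fun _ h => by
    rw [h.stack.1, h.arr]
    exact h.pop.push _

theorem store {A : Arr} :
    Exec ω n (.store A.ctorIdx (stackReg l.length) (stackReg (l.length + 1)))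
      σ (y :: x :: l) (σ.setArr A x y) l :=
  of_step rfl _ (fun _ _ => rfl) fun s h => by
    obtain ⟨hy, hx, -⟩ := h.stack
    rw [hx, show s.reg (stackReg (l.length + 1)) = y from hy]
    exact h.pop.pop.setArr A x y

theorem copy (l' : List ℕ) : Exec ω n (.copy (varReg v) (stackReg l.length))
    σ (l' ++ x :: l) (σ.setVar v x) (l' ++ x :: l) :=
  of_step rfl _ (fun _ _ => rfl) fun _ h => by
    rw [h.stack.apply]
    exact h.setVar v x

theorem slide : Exec ω n (.copy (stackReg l.length) (stackReg (l.length + 2)))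
    σ (x :: y :: k :: l) σ (x :: l) :=
  of_step rfl _ (fun _ _ => rfl) fun s h => by
    rw [show s.reg (stackReg (l.length + 2)) = x from h.stack.1]
    exact h.pop.pop.pop.push x

theorem pop (h : Exec ω n P σ l σ' (x :: l')) : Exec ω n P σ l σ' l' := fun s hs =>
  (h s hs).imp fun _ h => ⟨h.1, h.2.pop⟩

theorem ite (hP : x ≠ 0 → Exec ω n P σ l σ' l') (hQ : x = 0 → Exec ω n Q σ l σ' l') :
    Exec ω n (.ite (stackReg l.length) P Q) σ (x :: l) σ' l' := by
  intro s hs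
  have hcost : (cost (.ite (stackReg l.length) P Q)).eval n =
      1 + (cost P).eval n + (cost Q).eval n := by
    simp [cost]
  rw [hcost]
  rcases eq_or_ne x 0 with hx | hx
  · exact (hQ hx s hs.pop).imp fun _ h => ⟨.ite_neg (hs.stack.1.trans hx) h.1, h.2⟩
  · exact (hP hx s hs.pop).imp fun _ h => ⟨.ite_pos (hs.stack.1.trans_ne hx) h.1, h.2⟩

theorem loop {f : ℕ → Store → Store}
    (h : ∀ j σ, Exec ω n P σ ((j + 1) :: l) (f j σ) (j :: l)) :
    Exec ω n (.loop (stackReg l.length) P) σ (n :: l) (n.foldRev (fun j _ => f j) σ) l := by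
  suffices ∀ m σ s, Encodes n σ (m :: l) s → ∃ s',
      Runs ω (.loop (stackReg l.length) P) s s' (m * (1 + (cost P).eval n) + 1) ∧
        Encodes n (m.foldRev (fun j _ => f j) σ) l s' by
    simpa [Exec, cost] using this n σ
  intro m
  induction m with
  | zero =>
    intro σ s hs
    exact ⟨s, by simpa using Runs.loop_done hs.stack.1, hs.pop⟩
  | succ m ih =>
    intro σ s hs
    obtain ⟨s', hrun, hs'⟩ := h m σ s hs
    obtain ⟨s'', hrun', hs''⟩ := ih _ s' hs'
    refine ⟨s'', ?_, by simpa using hs''⟩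
    convert Runs.loop_more (by simp [hs.stack.1]) hrun hrun' using 1
    ring

theorem loop_counter {f : ℕ → Store → Store}
    (h : ∀ j σ, Exec ω n P (σ.setVar v j) (j :: l) (f j σ) (j :: l)) :
    Exec ω n (.loop (stackReg l.length) <| .seq (.const (stackReg (l.length + 1)) 1) <|
      .seq (.sub (stackReg l.length) (stackReg l.length) (stackReg (l.length + 1))) <|
      .seq (.copy (varReg v) (stackReg l.length)) P)
      σ (n :: l) (n.foldRev (fun j _ => f j) σ) l :=
  loop fun j σ => push_const.seq <| sub.seq <| (copy []).seq (h j σ)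

end Exec

@[simp]
theorem Store.var_setVar (σ : Store) (v w : Var) (x : ℕ) :
    (σ.setVar v x).var w = if w = v then x else σ.var w :=
  Function.update_apply _ _ _ _

theorem Store.setVar_setVar (σ : Store) (v : Var) (x y : ℕ) :
    (σ.setVar v x).setVar v y = σ.setVar v y := by
  simp [setVar]

theorem Store.setVar_var_self (σ : Store) (v : Var) : σ.setVar v (σ.var v) = σ := by
  simp [setVar]

theorem Store.setVar_setVar_setVar (σ : Store) (v w : Var) (x y z : ℕ) :
    ((σ.setVar v x).setVar w y).setVar v z = (σ.setVar w y).setVar v z := by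
  ext u
  · simp only [setVar, Function.update_apply]
    grind
  · rfl
  · rfl

theorem Store.exists_foldRev_setVar (f : Store → ℕ) (σ : Store) (v w : Var) (n x : ℕ) :
    ∃ y, n.foldRev (fun j _ τ => (τ.setVar v j).setVar w (f (τ.setVar v j))) (σ.setVar w x) =
      (σ.setVar v y).setVar w
        (n.foldRev (fun j _ x => f ((σ.setVar w x).setVar v j)) x) := by
  suffices ∀ y, ∃ z,
      n.foldRev (fun j _ τ => (τ.setVar v j).setVar w (f (τ.setVar v j)))
        ((σ.setVar v y).setVar w x) =
      (σ.setVar v z).setVar w (n.foldRev (fun j _ x => f ((σ.setVar w x).setVar v j)) x) by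
    simpa only [setVar_var_self] using this (σ.var v)
  induction n generalizing x with
  | zero => exact fun y => ⟨y, rfl⟩
  | succ n ih =>
    intro y
    simp only [Nat.foldRev_succ, setVar_setVar_setVar]
    exact ih _ n

theorem Expr.exec_compile (ω : ℕ → Bool) (n : ℕ) (a : Expr) (σ : Store) (l : List ℕ) :
    Exec ω n (a.compile l.length) σ l σ (a.eval n σ :: l) := by
  induction a generalizing σ l with
  | size => exact .push_size
  | const k => exact .push_const
  | var v => exact .push_var
  | add a b iha ihb => exact (iha σ l).seq <| (ihb σ _).seq .add
  | sub a b iha ihb => exact (iha σ l).seq <| (ihb σ _).seq .sub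
  | read A a iha => exact (iha σ l).seq .load
  | cond a b c iha ihb ihc =>
    refine (iha σ l).seq <| .ite (fun h => ?_) fun h => ?_
    · simpa [eval, h] using ihb σ l
    · simpa [eval, h] using ihc σ l
  | fold v w a b iha ihb =>
    obtain ⟨y, hy⟩ := Store.exists_foldRev_setVar (b.eval n) σ v w n (a.eval n σ)
    have hbody (j : ℕ) (τ : Store) :
        Exec ω n (.seq (b.compile (l.length + 3)) (.copy (varReg w) (stackReg (l.length + 3))))
          (τ.setVar v j) (j :: σ.var w :: σ.var v :: l)
          ((τ.setVar v j).setVar w (b.eval n (τ.setVar v j))) (j :: σ.var w :: σ.var v :: l) :=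
      (ihb _ _).seq (Exec.copy []).pop
    have hloop := Exec.loop_counter (σ := σ.setVar w (a.eval n σ)) hbody
    rw [hy] at hloop
    refine Exec.push_var.seq <| Exec.push_var.seq <| (iha σ _).seq <| (Exec.copy []).pop.seq <|
      Exec.push_size.seq <| hloop.seq <| Exec.push_var.seq <| (Exec.copy [_]).seq <|
      (Exec.copy [_, _]).seq ?_
    rw [Store.var_setVar, if_pos rfl, Store.setVar_setVar, Store.setVar_setVar_setVar,
      Store.setVar_var_self, Store.setVar_var_self]
    exact Exec.slide

theorem Prog.exec_compile (ω : ℕ → Bool) (n : ℕ) (p : Prog) (σ : Store) (l : List ℕ) :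
    Exec ω n (p.compile l.length) σ l (p.den ω n σ) l := by
  induction p generalizing σ l with
  | skip => exact .of_step rfl id (fun _ _ => rfl) fun _ h => h
  | assign v a => exact (a.exec_compile ω n σ l).seq (Exec.copy []).pop
  | write A a b => exact (a.exec_compile ω n σ l).seq <| (b.exec_compile ω n σ _).seq .store
  | flip v =>
    exact .of_step rfl _ (fun _ _ => rfl) fun s h => by
      have h' := h.setVar v (ω s.used).toNat
      rw [h.used] at h' ⊢
      exact ⟨h'.size, h'.var, h'.arr, rfl, h'.stack⟩
  | seq p q ihp ihq => exact (ihp σ l).seq (ihq _ l)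
  | ite a p q ihp ihq =>
    refine (a.exec_compile ω n σ l).seq <| .ite (fun h => ?_) fun h => ?_
    · simpa [den, h] using ihp σ l
    · simpa [den, h] using ihq σ l
  | forDown v p ih =>
    exact Exec.push_var.seq <| Exec.push_size.seq <|
      (Exec.loop_counter fun j σ => ih _ _).seq (Exec.copy []).pop

end Compilation

end RandRAM

/-! ### Reverse folds and frames -/

section FoldRev

variable {α β : Type*} {m n : ℕ} {P : ℕ → Prop} [DecidablePred P]

theorem foldRev_ite_eq_firstBelow :
    n.foldRev (fun j _ x => if P j then j else x) n = firstBelow n P := by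
  suffices ∀ m ≤ n, m.foldRev (fun j _ x => if P j then j else x)
      (firstBelow n fun j => m ≤ j ∧ P j) = firstBelow n P by
    have hn : firstBelow n (fun j => n ≤ j ∧ P j) = n :=
      firstBelow_le.antisymm <| not_lt.1 fun h => h.not_ge (firstBelow_spec h).1
    simpa only [hn] using this n le_rfl
  intro m hm
  induction m with
  | zero => simp
  | succ m ih =>
    rw [Nat.foldRev_succ, ← ih (by omega)]
    congr 1
    split_ifs with h
    · exact (firstBelow_eq hm ⟨le_rfl, h⟩ fun i hi hmi => hi.not_ge hmi.1).symm
    · refine firstBelow_congr fun j _ => ⟨fun hj => ⟨by omega, hj.2⟩, fun hj => ⟨?_, hj.2⟩⟩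
      exact lt_of_le_of_ne hj.1 fun hmj => h (hmj ▸ hj.2)

theorem foldRev_ite_add_one (x : ℕ) :
    n.foldRev (fun j _ x => if P j then x + 1 else x) x = x + {j ∈ Finset.range n | P j}.card := by
  induction n generalizing x with
  | zero => simp
  | succ n ih =>
    rw [Nat.foldRev_succ, ih, Finset.range_add_one, Finset.filter_insert]
    split_ifs
    · rw [Finset.card_insert_of_notMem (by simp), add_right_comm, add_assoc]
    · rfl

theorem foldRev_ite_lt (f : α → α) (a : α) (h : m ≤ n) :
    n.foldRev (fun j _ x => if j < m then f x else x) a = f^[m] a := by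
  induction n, h using Nat.le_induction generalizing a with
  | base =>
    induction m generalizing a with
    | zero => rfl
    | succ m ih =>
      rw [Nat.foldRev_succ, if_pos m.lt_succ_self, Function.iterate_succ_apply, ← ih]
      refine congrArg (fun g => Nat.foldRev m g (f a)) ?_
      funext j hj x
      rw [if_pos hj, if_pos (hj.trans m.lt_succ_self)]
  | succ n hn ih => rw [Nat.foldRev_succ, if_neg hn.not_gt, ih]

theorem foldRev_update (f : ℕ → α) (g : ℕ → α) :
    n.foldRev (fun j _ g => Function.update g j (f j)) g = fun j => if j < n then f j else g j := by
  induction n generalizing g with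
  | zero => simp
  | succ n ih =>
    rw [Nat.foldRev_succ, ih]
    ext j
    rcases lt_trichotomy j n with h | rfl | h
    · simp [h, h.trans n.lt_succ_self]
    · simp
    · simp [h.not_gt, h.ne', show ¬ j < n + 1 by omega]

theorem foldRev_iterate (f : α → α) (φ : α → β) (a : α) (T : ℕ → β) :
    n.foldRev (fun j _ x => (f x.1, Function.update x.2 j (φ (f x.1)))) (a, T) =
      (f^[n] a, fun j => if j < n then φ (f^[n - j] a) else T j) := by
  induction n generalizing a T with
  | zero => simp
  | succ n ih =>
    rw [Nat.foldRev_succ, ih, Function.iterate_succ_apply]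
    congr 1
    ext j
    rcases lt_trichotomy j n with h | rfl | h
    · simp [h, h.trans n.lt_succ_self, Nat.sub_add_comm h.le]
    · simp
    · simp [h.not_gt, h.ne', show ¬ j < n + 1 by omega]

theorem foldRev_update_zero (T c : ℕ → ℕ) (q : ℕ) :
    n.foldRev (fun k _ c => if P k then Function.update c (T k) 0 else c) c q =
      if ∃ k < n, P k ∧ T k = q then 0 else c q := by
  classical
  induction n generalizing c with
  | zero => simp
  | succ n ih =>
    rw [Nat.foldRev_succ, ih]
    simp only [Nat.exists_lt_succ_right]
    by_cases h : ∃ k < n, P k ∧ T k = q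
    · simp [h]
    · rw [if_neg h]
      simp only [h, false_or]
      split_ifs with hP hPT hPT
      · exact hPT.2 ▸ Function.update_self _ _ _
      · exact Function.update_of_ne (fun hq => hPT ⟨hP, hq.symm⟩) _ _
      · exact absurd hPT.1 hP
      · rfl

end FoldRev

namespace RandRAM

section Frame

/-- The names of the components of a store, for stating which of them a program changes. -/
inductive Loc : Type
  | var (v : Var)
  | arr (A : Arr)
  | coins
  deriving DecidableEq

/-- The parts of the store that a program may change. The loop variables are not among them because
they are restored. -/
def Prog.writes : Prog → List Loc
  | skip => []
  | assign v _ => [.var v]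
  | write A _ _ => [.arr A]
  | flip v => [.var v, .coins]
  | seq p q => p.writes ++ q.writes
  | ite _ p q => p.writes ++ q.writes
  | forDown _ p => p.writes

/-- The two stores agree outside `L`. -/
structure AgreeOff (L : List Loc) (σ τ : Store) : Prop where
  var : ∀ v, .var v ∉ L → τ.var v = σ.var v
  arr : ∀ A, .arr A ∉ L → τ.arr A = σ.arr A
  used : .coins ∉ L → τ.used = σ.used

variable {L L' : List Loc} {ω : ℕ → Bool} {n : ℕ} {σ τ ρ : Store}

theorem AgreeOff.refl (L : List Loc) (σ : Store) : AgreeOff L σ σ :=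
  ⟨fun _ _ => rfl, fun _ _ => rfl, fun _ => rfl⟩

theorem AgreeOff.trans (h : AgreeOff L σ τ) (h' : AgreeOff L τ ρ) : AgreeOff L σ ρ :=
  ⟨fun v hv => (h'.var v hv).trans (h.var v hv), fun A hA => (h'.arr A hA).trans (h.arr A hA),
    fun hL => (h'.used hL).trans (h.used hL)⟩

theorem AgreeOff.mono (h : AgreeOff L σ τ) (hL : L ⊆ L') : AgreeOff L' σ τ :=
  ⟨fun v hv => h.var v fun h' => hv (hL h'), fun A hA => h.arr A fun h' => hA (hL h'),
    fun hc => h.used fun h' => hc (hL h')⟩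

theorem AgreeOff.setVar (h : AgreeOff L σ τ) (v : Var) (x : ℕ) :
    AgreeOff L (σ.setVar v x) (τ.setVar v x) :=
  ⟨fun w hw => by simp [h.var w hw], h.arr, h.used⟩

theorem AgreeOff.foldRev {f : ℕ → Store → Store} {v : Var}
    (h : ∀ j τ, AgreeOff L (τ.setVar v j) (f j τ)) {x : ℕ} (hτ : AgreeOff L (σ.setVar v x) τ) :
    ∃ y, AgreeOff L (σ.setVar v y) (n.foldRev (fun j _ => f j) τ) := by
  induction n generalizing x τ with
  | zero => exact ⟨x, hτ⟩
  | succ n ih =>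
    refine ih (x := n) (AgreeOff.trans ?_ (h n τ))
    simpa only [Store.setVar_setVar] using hτ.setVar v n

theorem Prog.agreeOff_den (p : Prog) (σ : Store) : AgreeOff p.writes σ (p.den ω n σ) := by
  induction p generalizing σ with
  | skip => exact .refl _ _
  | assign v a => exact ⟨fun w hw => by simp_all [writes, den], fun _ _ => rfl, fun _ => rfl⟩
  | write A a b =>
    refine ⟨fun _ _ => rfl, fun B hB => ?_, fun _ => rfl⟩
    exact Function.update_of_ne (by simpa [writes] using hB) _ _
  | flip v =>
    refine ⟨fun w hw => ?_, fun _ _ => rfl, fun h => by simp [writes] at h⟩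
    exact Function.update_of_ne (by simp_all [writes]) _ _
  | seq p q ihp ihq =>
    exact ((ihp σ).mono (List.subset_append_left _ _)).trans
      ((ihq _).mono (List.subset_append_right _ _))
  | ite a p q ihp ihq =>
    rw [den]
    split_ifs
    · exact (ihp σ).mono (List.subset_append_left _ _)
    · exact (ihq σ).mono (List.subset_append_right _ _)
  | forDown v p ih =>
    obtain ⟨y, hy⟩ := AgreeOff.foldRev (n := n) (v := v) (fun j τ => ih (τ.setVar v j))
      (x := σ.var v) (by rw [Store.setVar_var_self]; exact .refl _ σ)
    rw [writes, den]
    simpa only [Store.setVar_setVar, Store.setVar_var_self] using hy.setVar v (σ.var v)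

theorem Prog.observe_forDown {β : Type*} (φ : Store → β) {v : Var} {p : Prog} (g : ℕ → β → β)
    (hφ : ∀ τ x, φ (τ.setVar v x) = φ τ)
    (h : ∀ j < n, ∀ τ, AgreeOff p.writes (σ.setVar v j) τ → φ (p.den ω n τ) = g j (φ τ)) :
    φ ((forDown v p).den ω n σ) = n.foldRev (fun j _ => g j) (φ σ) := by
  suffices ∀ m ≤ n, ∀ τ x, AgreeOff p.writes (σ.setVar v x) τ →
      φ (m.foldRev (fun j _ τ => p.den ω n (τ.setVar v j)) τ) =
        m.foldRev (fun j _ => g j) (φ τ) by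
    rw [den, hφ]
    exact this n le_rfl σ (σ.var v) (by rw [Store.setVar_var_self]; exact .refl _ σ)
  intro m hm
  induction m with
  | zero => exact fun _ _ _ => rfl
  | succ m ih =>
    intro τ x hτ
    have hτm : AgreeOff p.writes (σ.setVar v m) (τ.setVar v m) := by
      simpa only [Store.setVar_setVar] using hτ.setVar v m
    rw [Nat.foldRev_succ, Nat.foldRev_succ, ih (by omega) _ m (hτm.trans (p.agreeOff_den _)),
      h m (by omega) _ hτm, hφ]

end Frame

end RandRAM

/-! ### The program of a round -/

namespace EdgeArray

/-- The least `k` such that all degrees are less than `2 ^ (k + 1)`. -/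
def level (E : EdgeArray) : ℕ :=
  firstBelow E.size fun k =>
    ∀ j < E.size, (E.star (E.src j)).card < 2 ^ (k + 1) ∧ (E.star (E.dst j)).card < 2 ^ (k + 1)

end EdgeArray

namespace RandRAM

namespace Store

/-- The graph that is stored in the arrays `src` and `dst`. -/
def graph (n : ℕ) (σ : Store) : EdgeArray := ⟨n, σ.arr .src, σ.arr .dst⟩

/-- The position of the walk that is stored in the variables. -/
def walkPos (σ : Store) : WalkPos := ⟨σ.var .walkEdge, σ.var .walkVertex, σ.var .walkNext⟩

variable (σ : Store) (v w : Var) (A : Arr) (n i x : ℕ)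

@[simp]
theorem arr_setVar : (σ.setVar v x).arr = σ.arr := rfl

@[simp]
theorem used_setVar : (σ.setVar v x).used = σ.used := rfl

@[simp]
theorem graph_setVar : (σ.setVar v x).graph n = σ.graph n := rfl

@[simp]
theorem arr_setArr_self : (σ.setArr A i x).arr A = Function.update (σ.arr A) i x :=
  Function.update_self _ _ _

end Store

namespace Expr

variable {n : ℕ} {σ : Store} {a b w : Expr} {v : Var}

/-- Negation, where `0` means false and every other value means true. -/
def not (a : Expr) : Expr := .sub (.const 1) a

/-- Conjunction. -/
def and (a b : Expr) : Expr := .not (.add a.not b.not)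

/-- The comparison `a < b`. -/
def lt (a b : Expr) : Expr := .sub b a

/-- The test `a = b`. -/
def eq (a b : Expr) : Expr := .not (.add (.lt a b) (.lt b a))

theorem eval_not_ne_zero : a.not.eval n σ ≠ 0 ↔ ¬ a.eval n σ ≠ 0 := by
  simp only [not, eval]
  omega

theorem eval_add_ne_zero : (add a b).eval n σ ≠ 0 ↔ a.eval n σ ≠ 0 ∨ b.eval n σ ≠ 0 := by
  simp only [eval]
  omega

theorem eval_and_ne_zero : (and a b).eval n σ ≠ 0 ↔ a.eval n σ ≠ 0 ∧ b.eval n σ ≠ 0 := by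
  simp only [and, eval_not_ne_zero, eval_add_ne_zero]
  tauto

theorem eval_lt_ne_zero : (lt a b).eval n σ ≠ 0 ↔ a.eval n σ < b.eval n σ := Nat.sub_ne_zero_iff_lt

theorem eval_eq_ne_zero : (eq a b).eval n σ ≠ 0 ↔ a.eval n σ = b.eval n σ := by
  simp only [eq, eval_not_ne_zero, eval_add_ne_zero, eval_lt_ne_zero]
  omega

/-- The vertex `w` is an endpoint of the edge `a`. -/
def incident (a w : Expr) : Expr := .add (.eq (.read .src a) w) (.eq (.read .dst a) w)

theorem eval_incident_ne_zero :
    (incident a w).eval n σ ≠ 0 ↔ (σ.graph n).Inc (a.eval n σ) (w.eval n σ) := by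
  simp only [incident, eval_add_ne_zero, eval_eq_ne_zero]
  rfl

/-- The endpoint of the edge `a` other than `w`. -/
def otherEnd (a w : Expr) : Expr := .sub (.add (.read .src a) (.read .dst a)) w

/-- The least value of `v` for which `a` is not zero, or the number of edges if there is none. -/
def first (v : Var) (a : Expr) : Expr := .fold v .acc .size (.cond a (.var v) (.var .acc))

theorem eval_first {P : ℕ → Prop} (hv : v ≠ .acc)
    (h : ∀ j < n, ∀ x, a.eval n ((σ.setVar .acc x).setVar v j) ≠ 0 ↔ P j) :
    (first v a).eval n σ = firstBelow n P := by
  classical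
  rw [← foldRev_ite_eq_firstBelow]
  simp only [first, eval]
  congr 1
  funext j hj x
  simp only [if_congr (h j hj x) rfl rfl, Store.var_setVar, if_true, hv.symm, if_false]

/-- The number of edges at the vertex `w`. -/
def degree (w : Expr) : Expr :=
  .fold .j .acc (.const 0) (.cond (.incident (.var .j) w) (.add (.var .acc) (.const 1)) (.var .acc))

theorem eval_degree
    (hw : ∀ j x, w.eval n ((σ.setVar .acc x).setVar .j j) = w.eval n σ) :
    (degree w).eval n σ = ((σ.graph n).star (w.eval n σ)).card := by
  classical
  simp only [degree, eval, eval_incident_ne_zero, hw, Store.graph_setVar, Store.var_setVar,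
    if_true, reduceCtorEq, if_false, foldRev_ite_add_one, zero_add]
  rfl

/-- The number `2 ^ (k + 1)`, provided that the variable `k` is at most the number of edges. -/
def twoPowSucc : Expr :=
  .fold .j .acc (.const 2)
    (.cond (.lt (.var .j) (.var .k)) (.add (.var .acc) (.var .acc)) (.var .acc))

theorem eval_twoPowSucc (hk : σ.var .k ≤ n) : twoPowSucc.eval n σ = 2 ^ (σ.var .k + 1) := by
  simp only [twoPowSucc, eval, eval_lt_ne_zero, Store.var_setVar, if_true, reduceCtorEq, if_false,
    foldRev_ite_lt (fun x => x + x) 2 hk]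
  induction σ.var .k with
  | zero => rfl
  | succ k ih =>
    rw [Function.iterate_succ_apply', ih]
    ring

/-- The endpoints of the edge `i` have degrees less than `2 ^ (k + 1)`. -/
def smallDegrees : Expr :=
  .and (.lt (.degree (.read .src (.var .i))) .twoPowSucc)
    (.lt (.degree (.read .dst (.var .i))) .twoPowSucc)

theorem eval_smallDegrees_ne_zero (hk : σ.var .k ≤ n) :
    smallDegrees.eval n σ ≠ 0 ↔
      ((σ.graph n).star ((σ.graph n).src (σ.var .i))).card < 2 ^ (σ.var .k + 1) ∧
        ((σ.graph n).star ((σ.graph n).dst (σ.var .i))).card < 2 ^ (σ.var .k + 1) := by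
  simp only [smallDegrees, eval_and_ne_zero, eval_lt_ne_zero, eval_twoPowSucc hk]
  rw [eval_degree fun _ _ => rfl, eval_degree fun _ _ => rfl]
  rfl

/-- The level of the graph. -/
def level : Expr := .first .k (.not (.lt (.first .i (.not .smallDegrees)) .size))

theorem eval_level : level.eval n σ = (σ.graph n).level := by
  refine eval_first (by decide) fun k hk x => ?_
  have hfirst : (first .i smallDegrees.not).eval n ((σ.setVar .acc x).setVar .k k) =
      firstBelow n fun i => ¬ (((σ.graph n).star ((σ.graph n).src i)).card < 2 ^ (k + 1) ∧
        ((σ.graph n).star ((σ.graph n).dst i)).card < 2 ^ (k + 1)) :=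
    eval_first (by decide) fun _ _ _ =>
      eval_not_ne_zero.trans (not_congr (eval_smallDegrees_ne_zero hk.le))
  rw [eval_not_ne_zero, eval_lt_ne_zero, hfirst]
  simp only [eval, firstBelow_lt_iff]
  push Not
  rfl

end Expr

theorem AgreeOff.graph {L : List Loc} {σ τ : Store} {n : ℕ} (h : AgreeOff L σ τ)
    (hsrc : .arr .src ∉ L) (hdst : .arr .dst ∉ L) : τ.graph n = σ.graph n := by
  rw [Store.graph, h.arr _ hsrc, h.arr _ hdst, Store.graph]

namespace Prog

/-- Runs `p` if `a` is not zero. -/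
def when (a : Expr) (p : Prog) : Prog := .ite a p .skip

/-- One step of the two-colored walk. -/
def advance : Prog :=
  .seq (.assign .succ <| .first .i <|
      .and (.eq (.read .color (.var .i)) (.var .walkNext)) (.incident (.var .i) (.var .walkVertex)))
    <| .when (.and (.not (.eq (.var .walkEdge) (.var .edge))) (.lt (.var .succ) .size)) <|
      .seq (.assign .walkVertex (.otherEnd (.var .succ) (.var .walkVertex))) <|
      .seq (.assign .walkNext (.read .color (.var .walkEdge))) <|
      .assign .walkEdge (.var .succ)

/-- Begins the two-colored walk from `edge` over its second endpoint to the edge `a`. -/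
def startWalk (a : Expr) : Prog :=
  .seq (.assign .walkEdge a) <|
  .seq (.assign .walkVertex (.otherEnd (.var .walkEdge) (.read .dst (.var .edge)))) <|
  .assign .walkNext (.read .color (.var .edge))

/-- The two-colored walk from `edge` over its second endpoint to the edge `a`. Its edges are
stored in the array `trace`, from the last one to the first one. -/
def walk (a : Expr) : Prog :=
  .seq (.startWalk a) <| .forDown .k (.seq .advance (.write .trace (.var .k) (.var .walkEdge)))

/-- Assigns `j` to `closing` if the two-colored walk to `j` returns to `edge`. -/
def testClosing : Prog :=
  .when (.and (.read .color (.var .j)) <| .and (.not (.eq (.var .j) (.var .edge))) <|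
      .incident (.var .j) (.read .dst (.var .edge))) <|
    .seq (.walk (.var .j)) <|
      .when (.eq (.var .walkEdge) (.var .edge)) (.assign .closing (.var .j))

/-- Assigns to `closing` the first edge which starts a two-colored walk that returns to `edge`. -/
def findClosing : Prog := .seq (.assign .closing .size) <| .forDown .j .testClosing

/-- Uncolors all but the first two edges of the two-colored walk to `closing`. -/
def uncolor : Prog :=
  .seq (.walk (.var .closing)) <| .forDown .k <|
    .when (.lt (.add (.var .k) (.const 1)) .size) <|
      .write .color (.read .trace (.var .k)) (.const 0)

/-- Tries to give the color `color` to `edge`. -/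
def attempt : Prog :=
  .when (.not <| .lt (.first .j <| .and (.eq (.read .color (.var .j)) (.var .color)) <|
      .add (.incident (.var .j) (.read .src (.var .edge)))
        (.incident (.var .j) (.read .dst (.var .edge)))) .size) <|
    .seq (.write .color (.var .edge) (.var .color)) <|
    .seq .findClosing <| .when (.lt (.var .closing) .size) .uncolor

variable {ω : ℕ → Bool} {n : ℕ} {σ : Store} {a : Expr} {p : Prog}

theorem den_when {P : Prop} [Decidable P] (h : a.eval n σ ≠ 0 ↔ P) :
    (when a p).den ω n σ = if P then p.den ω n σ else σ := if_congr h rfl rfl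

theorem walkPos_advance :
    (advance.den ω n σ).walkPos =
      (σ.graph n).advance (σ.arr .color) (σ.var .edge) σ.walkPos := by
  classical
  let q := firstBelow n fun j =>
    σ.arr .color j = σ.var .walkNext ∧ (σ.graph n).Inc j (σ.var .walkVertex)
  have hfirst : (Expr.first .i <| .and (.eq (.read .color (.var .i)) (.var .walkNext))
      (.incident (.var .i) (.var .walkVertex))).eval n σ = q :=
    Expr.eval_first (by decide) fun j _ x => by
      rw [Expr.eval_and_ne_zero, Expr.eval_eq_ne_zero, Expr.eval_incident_ne_zero]
      rfl
  rw [advance, den, den, hfirst, den_when (P := σ.var .walkEdge ≠ σ.var .edge ∧ q < n)]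
  · rw [apply_ite Store.walkPos]
    rfl
  · rw [Expr.eval_and_ne_zero, Expr.eval_not_ne_zero, Expr.eval_eq_ne_zero, Expr.eval_lt_ne_zero]
    rfl

theorem den_walk :
    ((walk a).den ω n σ).walkPos =
        (σ.graph n).trace (σ.arr .color) (σ.var .edge) (a.eval n σ) n ∧
      ∀ k < n, ((walk a).den ω n σ).arr .trace k =
        ((σ.graph n).trace (σ.arr .color) (σ.var .edge) (a.eval n σ) (n - k)).edge := by
  let E := σ.graph n
  let f := E.advance (σ.arr .color) (σ.var .edge)
  have hloop := observe_forDown (fun ρ => (ρ.walkPos, ρ.arr .trace))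
    (fun j x => (f x.1, Function.update x.2 j (f x.1).edge))
    (ω := ω) (n := n) (σ := (startWalk a).den ω n σ) (v := .k)
    (p := .seq .advance (.write .trace (.var .k) (.var .walkEdge))) (fun _ _ => rfl)
    fun j _ ρ hρ => by
      have hadvance : (advance.den ω n ρ).walkPos = f ρ.walkPos := by
        rw [walkPos_advance, hρ.graph (by decide) (by decide), hρ.arr .color (by decide),
          hρ.var .edge (by decide)]
        rfl
      have hframe := advance.agreeOff_den (ω := ω) (n := n) ρ
      have hj : (advance.den ω n ρ).var .k = j :=
        (hframe.var .k (by decide)).trans (hρ.var .k (by decide))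
      have htrace : (advance.den ω n ρ).arr .trace = ρ.arr .trace := hframe.arr .trace (by decide)
      refine Prod.ext hadvance ?_
      rw [den, den, Store.arr_setArr_self, htrace]
      simp only [Expr.eval, hj, ← hadvance]
      rfl
  rw [foldRev_iterate f WalkPos.edge, Prod.ext_iff] at hloop
  exact ⟨hloop.1, fun k hk => (congrFun hloop.2 k).trans (if_pos hk)⟩

theorem closing_testClosing :
    (testClosing.den ω n σ).var .closing =
      open Classical in
      if (σ.graph n).Closes (σ.arr .color) (σ.var .edge) (σ.var .j) then σ.var .j
      else σ.var .closing := by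
  classical
  have htest : (Expr.and (.read .color (.var .j)) <| .and (.not (.eq (.var .j) (.var .edge))) <|
      .incident (.var .j) (.read .dst (.var .edge))).eval n σ ≠ 0 ↔
      σ.arr .color (σ.var .j) ≠ 0 ∧ σ.var .j ≠ σ.var .edge ∧
        (σ.graph n).Inc (σ.var .j) ((σ.graph n).dst (σ.var .edge)) := by
    rw [Expr.eval_and_ne_zero, Expr.eval_and_ne_zero, Expr.eval_not_ne_zero,
      Expr.eval_eq_ne_zero, Expr.eval_incident_ne_zero]
    rfl
  have hframe := (walk (.var .j)).agreeOff_den (ω := ω) (n := n) σ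
  have hedge : ((walk (.var .j)).den ω n σ).var .walkEdge =
      ((σ.graph n).trace (σ.arr .color) (σ.var .edge) (σ.var .j) n).edge :=
    congrArg WalkPos.edge den_walk.1
  rw [testClosing, den_when htest, den, den_when Expr.eval_eq_ne_zero]
  simp only [Expr.eval, apply_ite (fun τ : Store => τ.var .closing), den, Store.var_setVar, if_true,
    hedge, hframe.var .edge (by decide), hframe.var .j (by decide), hframe.var .closing (by decide)]
  rw [← ite_and]
  refine if_congr ?_ rfl rfl
  rw [EdgeArray.Closes, and_assoc, and_assoc]
  rfl

theorem closing_findClosing :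
    (findClosing.den ω n σ).var .closing =
      firstBelow n ((σ.graph n).Closes (σ.arr .color) (σ.var .edge)) := by
  classical
  rw [findClosing, den, ← foldRev_ite_eq_firstBelow]
  refine observe_forDown (fun ρ => ρ.var .closing) (fun j x =>
    if (σ.graph n).Closes (σ.arr .color) (σ.var .edge) j then j else x) (fun _ _ => rfl)
    fun j _ ρ hρ => ?_
  rw [closing_testClosing, hρ.graph (by decide) (by decide), hρ.arr .color (by decide),
    hρ.var .edge (by decide), hρ.var .j (by decide)]
  rfl

theorem color_uncolor :
    (uncolor.den ω n σ).arr .color =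
      (σ.graph n).uncolor (σ.arr .color) (σ.var .edge) (σ.var .closing) := by
  classical
  let T := ((walk (.var .closing)).den ω n σ).arr .trace
  have hloop := observe_forDown (fun ρ => ρ.arr .color)
    (fun k c => if k + 1 < n then Function.update c (T k) 0 else c)
    (ω := ω) (n := n) (σ := (walk (.var .closing)).den ω n σ) (v := .k)
    (p := .when (.lt (.add (.var .k) (.const 1)) .size) <|
      .write .color (.read .trace (.var .k)) (.const 0)) (fun _ _ => rfl)
    fun j _ ρ hρ => by
      rw [den_when Expr.eval_lt_ne_zero]
      simp only [Expr.eval, apply_ite (fun τ : Store => τ.arr .color), den, Store.arr_setArr_self,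
        hρ.var .k (by decide), hρ.arr .trace (by decide), Store.var_setVar, if_true]
      rfl
  ext q
  refine (congrFun hloop q).trans ?_
  rw [foldRev_update_zero]
  have hframe := (walk (.var .closing)).agreeOff_den (ω := ω) (n := n) σ
  rw [hframe.arr .color (by decide)]
  refine if_congr ⟨?_, ?_⟩ rfl rfl
  · rintro ⟨k, hk, hkn, hT⟩
    exact ⟨n - k, by omega, n.sub_le k, (den_walk.2 k hk).symm.trans hT⟩
  · rintro ⟨i, hi, hin, hT⟩
    have hin : i ≤ n := hin
    refine ⟨n - i, by omega, by omega, (den_walk.2 _ (by omega)).trans ?_⟩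
    rwa [Nat.sub_sub_self hin]

theorem color_attempt :
    (attempt.den ω n σ).arr .color =
      (σ.graph n).round (σ.arr .color) (σ.var .edge) (σ.var .color) := by
  classical
  let E := σ.graph n
  let c' := Function.update (σ.arr .color) (σ.var .edge) (σ.var .color)
  have hconflict : (Expr.first .j <| .and (.eq (.read .color (.var .j)) (.var .color)) <|
      .add (.incident (.var .j) (.read .src (.var .edge)))
        (.incident (.var .j) (.read .dst (.var .edge)))).eval n σ =
      firstBelow n (E.Conflict (σ.arr .color) (σ.var .edge) (σ.var .color)) :=
    Expr.eval_first (by decide) fun j _ x => by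
      rw [Expr.eval_and_ne_zero, Expr.eval_eq_ne_zero, Expr.eval_add_ne_zero,
        Expr.eval_incident_ne_zero, Expr.eval_incident_ne_zero]
      rfl
  rw [attempt, den_when (P := ¬ ∃ j < n, E.Conflict (σ.arr .color) (σ.var .edge) (σ.var .color) j)]
  swap
  · rw [Expr.eval_not_ne_zero, Expr.eval_lt_ne_zero, hconflict]
    exact not_congr firstBelow_lt_iff
  rw [EdgeArray.round, ite_not, apply_ite (fun τ : Store => τ.arr .color)]
  refine if_congr Iff.rfl rfl ?_
  rw [den]
  generalize hτ : den ω n (.write .color (.var .edge) (.var .color)) σ = τ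
  have hgraph : τ.graph n = E := by subst τ; rfl
  have hcolor : τ.arr .color = c' := by subst τ; exact Store.arr_setArr_self _ _ _ _
  have hedge : τ.var .edge = σ.var .edge := by subst τ; rfl
  have hclosing : (findClosing.den ω n τ).var .closing =
      firstBelow n (E.Closes c' (σ.var .edge)) := by
    rw [closing_findClosing, hgraph, hcolor, hedge]
  have hframe := findClosing.agreeOff_den (ω := ω) (n := n) τ
  have hcolor' : (findClosing.den ω n τ).arr .color = c' :=
    (hframe.arr .color (by decide)).trans hcolor
  rw [den, den_when Expr.eval_lt_ne_zero, apply_ite (fun τ : Store => τ.arr .color), color_uncolor,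
    hcolor', hframe.graph (by decide) (by decide), hframe.var .edge (by decide), hgraph, hedge]
  simp only [Expr.eval, hclosing, firstBelow_lt_iff]
  rfl

end Prog

end RandRAM

namespace EdgeArray

variable {E : EdgeArray}

theorem card_star_lt_two_pow_level (E : EdgeArray) (w : ℕ) :
    (E.star w).card < 2 ^ (E.level + 1) := by
  have hlevel : ∀ j < E.size, (E.star (E.src j)).card < 2 ^ (E.level + 1) ∧
      (E.star (E.dst j)).card < 2 ^ (E.level + 1) := by
    rcases (firstBelow_le : E.level ≤ E.size).lt_or_eq with h | h
    · exact firstBelow_spec h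
    · have hcard (w : ℕ) : (E.star w).card < 2 ^ (E.level + 1) :=
        calc (E.star w).card ≤ E.size := by
              simpa using Finset.card_le_card fun j hj => Finset.mem_range.2 (mem_star.1 hj).1
          _ < 2 ^ E.size := E.size.lt_two_pow_self
          _ ≤ 2 ^ (E.level + 1) := Nat.pow_le_pow_right two_pos (h.ge.trans E.level.le_succ)
      exact fun j _ => ⟨hcard _, hcard _⟩
  rcases (E.star w).eq_empty_or_nonempty with h | ⟨j, hj⟩
  · simp [h]
  · obtain ⟨hjE, rfl | rfl⟩ := mem_star.1 hj
    exacts [(hlevel j hjE).1, (hlevel j hjE).2]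

theorem exists_two_pow_level_le_card_star (hE : 0 < E.size) :
    ∃ w, 2 ^ E.level ≤ (E.star w).card := by
  rcases hlevel : E.level with _ | k
  · exact ⟨E.src 0, Finset.card_pos.2 ⟨0, mem_star.2 ⟨hE, .inl rfl⟩⟩⟩
  · by_contra! h
    exact not_of_lt_firstBelow (hlevel ▸ k.lt_succ_self : k < E.level) fun j _ => ⟨h _, h _⟩

end EdgeArray

namespace RandRAM

namespace Prog

/-- Writes the output and finds the next uncolored edge. Then `pending` is `0` if there is none. -/
def finish : Prog :=
  .seq (.forDown .j (.write .out (.var .j) (.sub (.read .color (.var .j)) (.const 1)))) <|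
  .seq (.assign .edge (.first .j (.eq (.read .color (.var .j)) (.const 0)))) <|
  .assign .pending (.sub .size (.var .edge))

/-- Appends a random bit to the binary number `color`. -/
def drawBit : Prog :=
  .seq (.flip .bit) (.assign .color (.add (.add (.var .color) (.var .color)) (.var .bit)))

/-- Draws a number `color` between `1` and `16 * 2 ^ level`. -/
def draw : Prog :=
  .seq (.assign .color (.const 0)) <|
  .seq (.seq (.seq drawBit drawBit) (.seq drawBit drawBit)) <|
  .seq (.forDown .k (.when (.lt (.var .k) (.var .level)) drawBit)) <|
  .assign .color (.add (.var .color) (.const 1))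

/-- One round of the algorithm. -/
def round : Prog := .seq draw <| .seq attempt finish

/-- The preparation of the first round. -/
def init : Prog := .seq (.assign .level .level) finish

variable {ω : ℕ → Bool} {n : ℕ} {σ : Store}

theorem out_finish {j : ℕ} (hj : j < n) :
    (finish.den ω n σ).arr .out j = σ.arr .color j - 1 := by
  have hloop := observe_forDown (fun ρ => ρ.arr .out)
    (fun j f => Function.update f j (σ.arr .color j - 1))
    (ω := ω) (n := n) (σ := σ) (v := .j)
    (p := .write .out (.var .j) (.sub (.read .color (.var .j)) (.const 1))) (fun _ _ => rfl)
    fun j _ ρ hρ => by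
      rw [den, Store.arr_setArr_self]
      simp only [Expr.eval, hρ.var .j (by decide), hρ.arr .color (by decide), Store.var_setVar,
        if_true]
      rfl
  rw [foldRev_update] at hloop
  exact (congrFun hloop j).trans (if_pos hj)

theorem edge_finish :
    (finish.den ω n σ).var .edge = (σ.graph n).next ((σ.graph n).supp (σ.arr .color)) := by
  let p : Prog := .forDown .j (.write .out (.var .j) (.sub (.read .color (.var .j)) (.const 1)))
  have hcolor : (p.den ω n σ).arr .color = σ.arr .color :=
    (p.agreeOff_den σ).arr .color (by decide)
  rw [EdgeArray.next_supp, ← hcolor]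
  exact Expr.eval_first (by decide) fun _ _ _ => Expr.eval_eq_ne_zero

theorem pending_finish :
    (finish.den ω n σ).var .pending = n - (finish.den ω n σ).var .edge := rfl

/-- Appends a coin to the binary number `x.1`, when `x.2` coins have been used. -/
def pushCoin (ω : ℕ → Bool) (x : ℕ × ℕ) : ℕ × ℕ := (x.1 + x.1 + (ω x.2).toNat, x.2 + 1)

theorem iterate_pushCoin (ω : ℕ → Bool) (m k : ℕ) :
    (pushCoin ω)^[k] (0, m) = (bits ω m k, m + k) := by
  induction k with
  | zero => rfl
  | succ k ih =>
    rw [Function.iterate_succ_apply', ih]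
    rfl

theorem pushCoin_drawBit :
    ((drawBit.den ω n σ).var .color, (drawBit.den ω n σ).used) =
      pushCoin ω (σ.var .color, σ.used) := rfl

theorem color_used_draw (h : σ.var .level ≤ n) :
    ((draw.den ω n σ).var .color, (draw.den ω n σ).used) =
      (bits ω σ.used (4 + σ.var .level) + 1, σ.used + (4 + σ.var .level)) := by
  let p : Prog := .seq (.assign .color (.const 0)) <|
    .seq (.seq drawBit drawBit) (.seq drawBit drawBit)
  let τ := p.den ω n σ
  have hlevel : τ.var .level = σ.var .level := (p.agreeOff_den σ).var .level (by decide)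
  have hloop := observe_forDown (fun ρ => (ρ.var .color, ρ.used))
    (fun k x => if k < σ.var .level then pushCoin ω x else x)
    (ω := ω) (n := n) (σ := τ) (v := .k)
    (p := .when (.lt (.var .k) (.var .level)) drawBit) (fun _ _ => rfl)
    fun k _ ρ hρ => by
      rw [den_when Expr.eval_lt_ne_zero]
      simp only [Expr.eval, apply_ite (fun τ : Store => (τ.var .color, τ.used)), pushCoin_drawBit,
        hρ.var .k (by decide), hρ.var .level (by decide), Store.var_setVar, if_true, hlevel,
        reduceCtorEq, if_false]
  have hfour : (τ.var .color, τ.used) = (pushCoin ω)^[4] (0, σ.used) := rfl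
  rw [foldRev_ite_lt _ _ h, hfour, ← Function.iterate_add_apply, add_comm,
    iterate_pushCoin] at hloop
  exact congrArg (fun x : ℕ × ℕ => (x.1 + 1, x.2)) hloop

end Prog

/-- The contents of the store between two rounds of the algorithm, for the graph `E` with the
partial coloring `c`, when `m` coins have been used. -/
structure Ready (E : EdgeArray) (c : ℕ → ℕ) (m : ℕ) (σ : Store) : Prop where
  graph : σ.graph E.size = E
  level : σ.var .level = E.level
  color : σ.arr .color = c
  out : ∀ j < E.size, σ.arr .out j = c j - 1
  edge : σ.var .edge = E.next (E.supp c)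
  pending : σ.var .pending = E.size - E.next (E.supp c)
  used : σ.used = m

variable {ω : ℕ → Bool} {E : EdgeArray} {c : ℕ → ℕ} {m : ℕ} {σ : Store}

theorem Ready.pending_ne_zero_iff (h : Ready E c m σ) :
    σ.var .pending ≠ 0 ↔ E.supp c ⊂ Finset.range E.size := by
  rw [h.pending, Nat.sub_ne_zero_iff_lt, EdgeArray.next_supp, firstBelow_lt_iff,
    EdgeArray.supp_ssubset_iff]

theorem ready_finish (hgraph : σ.graph E.size = E) (hlevel : σ.var .level = E.level) :
    Ready E (σ.arr .color) σ.used (Prog.finish.den ω E.size σ) := by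
  have hframe := Prog.finish.agreeOff_den (ω := ω) (n := E.size) σ
  have hedge : (Prog.finish.den ω E.size σ).var .edge = E.next (E.supp (σ.arr .color)) := by
    rw [Prog.edge_finish, hgraph]
  exact
    { graph := (hframe.graph (by decide) (by decide)).trans hgraph
      level := (hframe.var .level (by decide)).trans hlevel
      color := hframe.arr .color (by decide)
      out := fun j hj => Prog.out_finish hj
      edge := hedge
      pending := hedge ▸ Prog.pending_finish
      used := hframe.used (by decide) }

theorem ready_init (hgraph : σ.graph E.size = E) (hcolor : σ.arr .color = fun _ => 0)
    (hused : σ.used = 0) : Ready E (fun _ => 0) 0 (Prog.init.den ω E.size σ) := by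
  have h := ready_finish (ω := ω) (σ := σ.setVar .level (Expr.level.eval E.size σ)) hgraph <| by
    rw [Store.var_setVar, if_pos rfl, Expr.eval_level, hgraph]
  rwa [Store.arr_setVar, Store.used_setVar, hcolor, hused] at h

theorem Ready.round (h : Ready E c m σ) :
    Ready E (E.round c (E.next (E.supp c)) (bits ω m (4 + E.level) + 1)) (m + (4 + E.level))
      (Prog.round.den ω E.size σ) := by
  have hdraw := Prog.draw.agreeOff_den (ω := ω) (n := E.size) σ
  let τ := Prog.draw.den ω E.size σ
  have hattempt := Prog.attempt.agreeOff_den (ω := ω) (n := E.size) τ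
  obtain ⟨hcolor, hused⟩ :
      τ.var .color = bits ω m (4 + E.level) + 1 ∧ τ.used = m + (4 + E.level) := by
    simpa only [Prod.mk.injEq, h.used, h.level] using
      Prog.color_used_draw (ω := ω) (h.level.trans_le firstBelow_le)
  have hgraph : τ.graph E.size = E := (hdraw.graph (by decide) (by decide)).trans h.graph
  have hlevel : τ.var .level = E.level := (hdraw.var .level (by decide)).trans h.level
  have hready := ready_finish (ω := ω) ((hattempt.graph (by decide) (by decide)).trans hgraph)
    ((hattempt.var .level (by decide)).trans hlevel)
  rw [Prog.color_attempt, hgraph, hdraw.arr .color (by decide), h.color,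
    hdraw.var .edge (by decide), h.edge, hcolor, hattempt.used (by decide), hused] at hready
  exact hready

theorem Ready.process_succ {t : ℕ}
    (h : Ready E (E.process (4 + E.level) ω t) ((4 + E.level) * t) σ)
    (hpending : σ.var .pending ≠ 0) :
    Ready E (E.process (4 + E.level) ω (t + 1)) ((4 + E.level) * (t + 1))
      (Prog.round.den ω E.size σ) := by
  rw [EdgeArray.process, if_pos, Nat.mul_succ]
  · exact h.round
  · rwa [h.pending, Nat.sub_ne_zero_iff_lt] at hpending

end RandRAM

/-! ### The algorithm -/

namespace EdgeArray

/-- The edge array of a list of pairs of vertices. -/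
def ofList {v : ℕ} (es : List (Fin v × Fin v)) : EdgeArray where
  size := es.length
  src i := (es.map fun p => (p.1 : ℕ)).getD i 0
  dst i := (es.map fun p => (p.2 : ℕ)).getD i 0

variable {v : ℕ} {G : SimpleGraph (Fin v)} {es : List (Fin v × Fin v)}

/-- The numbering of the edges of a graph by an edge listing. -/
def edgeEquiv (h : G.IsEdgeListing es) : Fin (ofList es).size ≃ G.edgeSet :=
  ((finCongr (List.length_map _).symm).trans (h.nodup.getEquiv _)).trans
    (Equiv.subtypeEquivRight h.mem_iff)

theorem coe_edgeEquiv (h : G.IsEdgeListing es) {i : ℕ} (hi : i < es.length) :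
    (edgeEquiv h ⟨i, hi⟩ : Sym2 (Fin v)) = s(es[i].1, es[i].2) :=
  List.getElem_map _

theorem represents_ofList (h : G.IsEdgeListing es) :
    (ofList es).Represents G (edgeEquiv h) where
  inc_iff i x := by
    have hi : (i : ℕ) < es.length := i.2
    rw [coe_edgeEquiv h hi, Sym2.mem_iff]
    simp [Inc, ofList, hi, Fin.ext_iff, eq_comm]
  src_lt i := by
    have hi : (i : ℕ) < es.length := i.2
    simp [ofList, hi]
  dst_lt i := by
    have hi : (i : ℕ) < es.length := i.2
    simp [ofList, hi]

variable {E : EdgeArray} {ed : Fin E.size ≃ G.edgeSet}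

theorem Represents.card_star_le_maxDegree [DecidableRel G.Adj] (hR : E.Represents G ed) (w : ℕ) :
    (E.star w).card ≤ G.maxDegree := by
  rcases (E.star w).eq_empty_or_nonempty with h | ⟨j, hj⟩
  · simp [h]
  have hw : w < v := hR.lt_of_inc (i := ⟨j, (mem_star.1 hj).1⟩) (mem_star.1 hj).2
  refine le_trans ?_ (G.degree_le_maxDegree ⟨w, hw⟩)
  rw [← G.card_incidenceFinset_eq_degree, ← Finset.card_attach]
  refine Finset.card_le_card_of_injOn
    (fun j => (ed ⟨j, (mem_star.1 j.2).1⟩ : Sym2 (Fin v))) (fun j _ => ?_) fun i _ j _ hij => ?_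
  · rw [Finset.mem_coe, SimpleGraph.mem_incidenceFinset]
    exact ⟨(ed _).2, (hR.inc_iff _ ⟨w, hw⟩).1 (mem_star.1 j.2).2⟩
  · exact Subtype.ext (Fin.mk.inj (ed.injective (Subtype.ext hij)))

theorem Represents.noBichromaticCycle_process (hR : E.Represents G ed) (k : ℕ) (ω : ℕ → Bool)
    (t : ℕ) : E.NoBichromaticCycle G ed (E.process k ω t) := by
  induction t with
  | zero => exact hR.noBichromaticCycle_zero
  | succ t ih =>
    rw [process]
    split_ifs with h
    · exact noBichromaticCycle_round hR (isPartial_process hR.simple k ω t).proper ih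
        (Nat.succ_ne_zero _) (e := ⟨_, h⟩)
    · exact ih

end EdgeArray

namespace RandRAM

section Loop

theorem run_eq_of_haltedBy {ω : ℕ → Bool} {P : Cmd} {s₀ : State} {a b : ℕ} (ha : HaltedBy P s₀ ω a)
    (hab : a ≤ b) : run P s₀ ω b = run P s₀ ω a := by
  obtain ⟨d, rfl⟩ := Nat.exists_eq_add_of_le' hab
  have hfix : step ω (run P s₀ ω a) = run P s₀ ω a := by
    rw [HaltedBy] at ha
    generalize run P s₀ ω a = x at ha ⊢
    obtain ⟨K, s⟩ := x
    obtain rfl : K = [] := ha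
    rfl
  rw [run, Function.iterate_add_apply]
  exact Function.iterate_fixed hfix d

/-- With coins `ω` the program `.seq P (.loop r Q)` maintains `I` from the memory `s₀` on: `I t`
holds after `t` rounds of the loop, there is a further round if and only if `D t` holds, and `P`
makes at most `T₀` steps and every round at most `T` steps. -/
structure LoopInvariant (ω : ℕ → Bool) (P Q : Cmd) (r : ℕ) (s₀ : State) (T₀ T : ℕ)
    (D : ℕ → Prop) (I : ℕ → State → Prop) : Prop where
  init : ∃ s, Runs ω P s₀ s T₀ ∧ I 0 s
  reg_ne_zero_iff : ∀ {t s}, I t s → (s.reg r ≠ 0 ↔ D t)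
  round : ∀ {t s}, I t s → D t → ∃ s', Runs ω Q s s' T ∧ I (t + 1) s'

namespace LoopInvariant

variable {ω : ℕ → Bool} {P Q : Cmd} {r : ℕ} {s₀ : State} {T₀ T t τ : ℕ} {D : ℕ → Prop}
  {I : ℕ → State → Prop}

theorem exists_run_eq_loop (h : LoopInvariant ω P Q r s₀ T₀ T D I) (hD : ∀ t' < t, D t') :
    ∃ s τ, I t s ∧ t ≤ τ ∧ τ ≤ 1 + T₀ + t * (1 + T) ∧
      run (.seq P (.loop r Q)) s₀ ω τ = ⟨[.loop r Q], s⟩ := by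
  induction t with
  | zero =>
    obtain ⟨s, ⟨τ, hτ, hrun⟩, hs⟩ := h.init
    refine ⟨s, τ + 1, hs, Nat.zero_le _, by omega, ?_⟩
    rw [run, Function.iterate_succ_apply]
    exact hrun _
  | succ t ih =>
    obtain ⟨s, τ, hs, hτ, hτ', hrun⟩ := ih fun t' ht' => hD t' (Nat.lt_succ_of_lt ht')
    have ht := hD t t.lt_succ_self
    obtain ⟨s', ⟨d, hd, hround⟩, hs'⟩ := h.round hs ht
    refine ⟨s', d + (1 + τ), hs', by omega, by rw [Nat.succ_mul]; omega, ?_⟩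
    rw [run] at hrun ⊢
    rw [Function.iterate_add_apply, Function.iterate_add_apply, hrun, ← hround [.loop r Q]]
    exact congrArg _ (if_pos ((h.reg_ne_zero_iff hs).2 ht))

theorem exists_run_eq_nil (h : LoopInvariant ω P Q r s₀ T₀ T D I) (hD : ∀ t' < t, D t')
    (ht : ¬ D t) :
    ∃ s τ, I t s ∧ τ ≤ T₀ + 2 + t * (T + 1) ∧ run (.seq P (.loop r Q)) s₀ ω τ = ⟨[], s⟩ := by
  obtain ⟨s, τ, hs, -, hτ, hrun⟩ := h.exists_run_eq_loop hD
  refine ⟨s, τ + 1, hs, by rw [add_comm T]; omega, ?_⟩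
  rw [run] at hrun ⊢
  rw [Function.iterate_succ_apply', hrun]
  exact if_neg fun hr => ht ((h.reg_ne_zero_iff hs).1 hr)

theorem exists_of_haltedBy (h : LoopInvariant ω P Q r s₀ T₀ T D I)
    (hτ : HaltedBy (.seq P (.loop r Q)) s₀ ω τ) :
    ∃ t, ¬ D t ∧ I t (run (.seq P (.loop r Q)) s₀ ω τ).state := by
  classical
  by_cases hD : ∃ t, ¬ D t
  · obtain ⟨s, τ', hs, -, hrun⟩ :=
      h.exists_run_eq_nil (fun t' ht' => not_not.1 (Nat.find_min hD ht')) (Nat.find_spec hD)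
    have hτ' : HaltedBy (.seq P (.loop r Q)) s₀ ω τ' := congrArg Config.todo hrun
    refine ⟨Nat.find hD, Nat.find_spec hD, ?_⟩
    rw [← run_eq_of_haltedBy hτ (le_max_left τ τ'), run_eq_of_haltedBy hτ' (le_max_right τ τ'),
      hrun]
    exact hs
  · push Not at hD
    obtain ⟨s, τ', -, hle, -, hrun⟩ := h.exists_run_eq_loop (t := τ) fun t' _ => hD t'
    rw [run_eq_of_haltedBy hτ hle] at hrun
    rw [HaltedBy, hrun] at hτ
    cases hτ

theorem runningTime_le (h : LoopInvariant ω P Q r s₀ T₀ T D I) :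
    runningTime (.seq P (.loop r Q)) s₀ ω ≤
      (T₀ + 2 : ℕ) + ∑' t, open Classical in if D t then ((T + 1 : ℕ) : ℝ≥0∞) else 0 := by
  classical
  by_cases hD : ∃ t, ¬ D t
  · have hmin : ∀ t < Nat.find hD, D t := fun t ht => not_not.1 (Nat.find_min hD ht)
    obtain ⟨s, τ, -, hτ, hrun⟩ := h.exists_run_eq_nil hmin (Nat.find_spec hD)
    calc runningTime (.seq P (.loop r Q)) s₀ ω ≤ τ := iInf₂_le τ (congrArg Config.todo hrun)
      _ ≤ (T₀ + 2 + Nat.find hD * (T + 1) : ℕ) := Nat.cast_le.2 hτ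
      _ = (T₀ + 2 : ℕ) + ∑ t ∈ Finset.range (Nat.find hD),
            if D t then ((T + 1 : ℕ) : ℝ≥0∞) else 0 := by
          rw [Finset.sum_congr rfl fun t ht => if_pos (hmin t (Finset.mem_range.1 ht))]
          push_cast [Finset.sum_const, Finset.card_range, nsmul_eq_mul]
          rfl
      _ ≤ _ := by gcongr; exact ENNReal.sum_le_tsum _
  · push Not at hD
    simp only [hD, if_true]
    rw [ENNReal.tsum_const_eq_top_of_ne_zero (by simp), add_top]
    exact le_top

end LoopInvariant

end Loop

section Algorithm

/-- The randomized algorithm: as long as there is an uncolored edge, the first one gets a random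
color, and if this closes a two-colored cycle, all but two of its edges lose their colors. -/
def algorithm : Cmd :=
  .seq (Prog.init.compile 0) (.loop (varReg .pending) (Prog.round.compile 0))

/-- The event that some edge is uncolored after `t` rounds. -/
def incomplete (E : EdgeArray) (t : ℕ) : Set (ℕ → Bool) :=
  {ω | E.supp (E.process (4 + E.level) ω t) ⊂ Finset.range E.size}

/-- The store at the start of the algorithm. -/
def initialStore {v : ℕ} (es : List (Fin v × Fin v)) : Store where
  var _ := 0
  arr A := (graphInput es).arr A.ctorIdx
  used := 0

variable {v : ℕ} {G : SimpleGraph (Fin v)} {es : List (Fin v × Fin v)} {ω : ℕ → Bool} {τ : ℕ}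

theorem encodes_graphInput (es : List (Fin v × Fin v)) :
    Encodes es.length (initialStore es) [] (graphInput es) where
  size := rfl
  var v := by simp [graphInput, initialStore, varReg]
  arr _ := rfl
  used := rfl
  stack := trivial

theorem loopInvariant_algorithm (es : List (Fin v × Fin v)) (ω : ℕ → Bool) :
    LoopInvariant ω (Prog.init.compile 0) (Prog.round.compile 0) (varReg .pending) (graphInput es)
      ((cost (Prog.init.compile 0)).eval es.length) ((cost (Prog.round.compile 0)).eval es.length)
      (ω ∈ incomplete (.ofList es) ·) fun t s =>
        ∃ σ, Encodes es.length σ [] s ∧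
          Ready (.ofList es) ((EdgeArray.ofList es).process (4 + (EdgeArray.ofList es).level) ω t)
            ((4 + (EdgeArray.ofList es).level) * t) σ where
  init :=
    let ⟨s, hrun, hs⟩ := Prog.init.exec_compile ω _ _ [] _ (encodes_graphInput es)
    ⟨s, hrun, _, hs, ready_init rfl rfl rfl⟩
  reg_ne_zero_iff := by
    rintro t s ⟨σ, hs, hσ⟩
    rw [hs.var, hσ.pending_ne_zero_iff]
    rfl
  round := by
    rintro t s ⟨σ, hs, hσ⟩ hD
    obtain ⟨s', hrun, hs'⟩ := Prog.round.exec_compile ω _ _ [] _ hs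
    exact ⟨s', hrun, _, hs', hσ.process_succ (hσ.pending_ne_zero_iff.2 hD)⟩

theorem exists_holdsColoring_algorithm [DecidableRel G.Adj] (hes : G.IsEdgeListing es)
    (hτ : HaltedBy algorithm (graphInput es) ω τ) :
    ∃ c : G.EdgeLabeling (Fin (16 * G.maxDegree)), G.IsAcyclicEdgeColoring c ∧
      HoldsColoring es c (run algorithm (graphInput es) ω τ).state := by
  obtain ⟨t, ht, σ, hs, hσ⟩ := (loopInvariant_algorithm es ω).exists_of_haltedBy hτ
  let E := EdgeArray.ofList es
  let c := E.process (4 + E.level) ω t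
  have hR := EdgeArray.represents_ofList hes
  have hc : E.IsPartial (2 ^ (4 + E.level)) c := EdgeArray.isPartial_process hR.simple _ ω t
  have hcolored (i : ℕ) (hi : i < E.size) : c i ≠ 0 := fun h =>
    ht (EdgeArray.supp_ssubset_iff.2 ⟨i, hi, h⟩)
  have hle (i : ℕ) (hi : i < E.size) : c i ≤ 16 * G.maxDegree := by
    obtain ⟨w, hw⟩ := EdgeArray.exists_two_pow_level_le_card_star (i.zero_le.trans_lt hi)
    calc c i ≤ 2 ^ (4 + E.level) := hc.le i
      _ = 16 * 2 ^ E.level := pow_add _ _ _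
      _ ≤ 16 * G.maxDegree := Nat.mul_le_mul_left _ (hw.trans (hR.card_star_le_maxDegree w))
  obtain ⟨C, hC, hCc⟩ := EdgeArray.exists_isAcyclicEdgeColoring hR hc.proper
    (hR.noBichromaticCycle_process _ ω t) hcolored hle
  refine ⟨C, hC, fun i hi hmem => ?_⟩
  have hed : EdgeArray.edgeEquiv hes ⟨i, hi⟩ = ⟨s(es[i].1, es[i].2), hmem⟩ :=
    Subtype.ext (EdgeArray.coe_edgeEquiv hes hi)
  rw [← hed, hCc ⟨i, hi⟩, ← hσ.out i hi]
  exact congrFun (hs.arr .out) i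

/-- A bound for the expected running time on a graph with `X` edges. -/
def timeBound : Polynomial ℕ :=
  cost (Prog.init.compile 0) + 2 +
    (cost (Prog.round.compile 0) + 1) * (3 * Polynomial.X + 5)

theorem measurableSet_incomplete (E : EdgeArray) (t : ℕ) : MeasurableSet (incomplete E t) :=
  measurableSet_of_dependsOn (m := (4 + E.level) * t) fun ω ω' h => by
    have hcongr : E.process (4 + E.level) ω t = E.process (4 + E.level) ω' t :=
      E.dependsOn_process _ t h
    simp only [incomplete, Set.mem_ofPred_eq, hcongr]

theorem tsum_coinMeasure_incomplete_le {E : EdgeArray} (hE : E.Simple) :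
    ∑' t, coinMeasure (incomplete E t) ≤ (3 * E.size + 5 : ℕ) :=
  EdgeArray.tsum_measure_incomplete_le hE (Δ := 2 ^ (E.level + 1)) (H := 2 ^ (E.level + 3))
    (fun w => (E.card_star_lt_two_pow_level w).le) (by positivity) (by ring_nf; rfl) (by ring)

theorem expectedTime_algorithm_le (hes : G.IsEdgeListing es) :
    expectedTime algorithm (graphInput es) ≤ (timeBound.eval es.length : ℕ) := by
  classical
  let E := EdgeArray.ofList es
  let a := (cost (Prog.init.compile 0)).eval es.length
  let b := (cost (Prog.round.compile 0)).eval es.length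
  have hmeas := measurableSet_incomplete E
  calc expectedTime algorithm (graphInput es)
      ≤ ∫⁻ ω, (a + 2 : ℕ) + ∑' t, (incomplete E t).indicator (fun _ => ((b + 1 : ℕ) : ℝ≥0∞)) ω
          ∂coinMeasure := by
        refine MeasureTheory.lintegral_mono fun ω => ?_
        simp only [Set.indicator_apply]
        exact (loopInvariant_algorithm es ω).runningTime_le.trans_eq (by congr!)
    _ = (a + 2 : ℕ) + ∑' t, (b + 1 : ℕ) * coinMeasure (incomplete E t) := by
        rw [MeasureTheory.lintegral_add_left measurable_const, MeasureTheory.lintegral_const,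
          MeasureTheory.measure_univ, mul_one, MeasureTheory.lintegral_tsum fun t =>
            (measurable_const.indicator (hmeas t)).aemeasurable]
        simp only [MeasureTheory.lintegral_indicator_const (hmeas _)]
    _ ≤ (a + 2 : ℕ) + (b + 1 : ℕ) * (3 * E.size + 5 : ℕ) := by
        rw [ENNReal.tsum_mul_left]
        gcongr
        exact tsum_coinMeasure_incomplete_le (EdgeArray.represents_ofList hes).simple
    _ = (timeBound.eval es.length : ℕ) := by
        simp [timeBound, a, b, E, EdgeArray.ofList]

end Algorithm

end RandRAM

end

theorem theorem6p1 :
    ∃ (P : RandRAM.Cmd) (p : Polynomial ℕ),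
      ∀ (v : ℕ) (G : SimpleGraph (Fin v)) [DecidableRel G.Adj] (es : List (Fin v × Fin v)),
        G.IsEdgeListing es →
          (∀ (ω : ℕ → Bool) (t : ℕ), RandRAM.HaltedBy P (RandRAM.graphInput es) ω t →
            ∃ c : G.EdgeLabeling (Fin (16 * G.maxDegree)),
              G.IsAcyclicEdgeColoring c ∧
                RandRAM.HoldsColoring es c (RandRAM.run P (RandRAM.graphInput es) ω t).state) ∧
          RandRAM.expectedTime P (RandRAM.graphInput es) ≤ ((p.eval es.length : ℕ) : ℝ≥0∞) := by
  refine ⟨RandRAM.algorithm, RandRAM.timeBound, fun v G _ es hes => ⟨fun ω t h => ?_, ?_⟩⟩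
  · exact RandRAM.exists_holdsColoring_algorithm hes h
  · exact RandRAM.expectedTime_algorithm_le hes
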